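/- Throughout, $\mathcal M_2$ is the algebra of complex $2\times 2$ matrices and $|\cdot|$ is the operator norm induced by the Euclidean norm of $\mathbb C^2$. Let $B=\begin{pmatrix}0&1\\-1&0\end{pmatrix}$. For every integer $p\ge 0$ there is a constant $C>0$, depending only on $p$, such that the following holds for every $b>0$ and every potential $Q=\begin{pmatrix}u&v\\v&-u\end{pmatrix}\in C^{p+1}([0,b],\mathcal M_2)$ with complex-valued $u,v$. For each $\lambda\in\mathbb C$ let $U(\lambda,\cdot)$ be the solution on $[0,b]$ of $BU'+QU=\lambda U$, $U(\lambda,0)=I$ (it exists), and let $U_0(\lambda,x)=\begin{pmatrix}\cos\lambda x&-\sin\lambda x\\ \sin\lambda x&\cos\lambda x\end{pmatrix}$. Let $K$ be the transmutation kernel, i.e. the $C^1$ solution on $\Omega^+=\{(x,t):0\le x\le b,\ |t|\le x\}$ of the Goursat problem $$BK_x+K_tB=-Q(x)K,\qquad BK(x,x)-K(x,x)B=-Q(x),\qquad BK(x,-x)+K(x,-x)B=0$$ (it exists, and belongs to $C^{p+1}(\Omega^+,\mathcal M_2)$). Put $$K_n(x)=\frac{2n+1}{2}\int_{-x}^{x}K(x,t)\,P_n\!\left(\frac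 tx\right)dt,\qquad \tilde K_n(x)=\begin{cases}2(-1)^{n/2}K_n(x),& n\text{ even},\\ 2(-1)^{(n+1)/2}K_n(x)B,& n\text{ odd},\end{cases}$$ with $P_n$ the Legendre polynomials and $K_n(0)=0$, and let $$U^N(\lambda,x)=U_0(\lambda,x)+\sum_{n=0}^{N}\tilde K_n(x)\,j_n(\lambda x)$$ be the $N$-th partial sum of the Neumann series of Bessel functions, where $j_n$ is the spherical Bessel function of the first kind of order $n$. Set $$M=\max_{(x,t)\in\Omega^+}\left|\partial_t^{p+1}K(x,t)\right|,\qquad \varepsilon_N(x)=\frac{C\,M\,x^{p+1}}{N^{p+1/2}} .$$ Then for every integer $N>p+1$ and every $x\in[0,b]$: (a) for all $\lambda\in\mathbb R$, $\ |U(\lambda,x)-U^N(\lambda,x)|\le 2x\,\varepsilon_N(x)$, a bound uniform in $\lambda$; (b) for all $\lambda\in\mathbb C$ with $\operatorname{Im}\lambda\ne0$, $$|U(\lambda,x)-U^N(\lambda,x)|\le 2\,\varepsilon_N(x)\,\frac{e^{|\operatorname{Im}\lambda|x}-1}{|\operatorname{Im}\lambda|}.$$ -/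

import Mathlib

open scoped Matrix.Norms.L2Operator

namespace DiracNSBF

noncomputable section

/-- Complex `2 × 2` matrices; the norm is the operator norm induced by the Euclidean norm
of `ℂ²` (opened above). -/
abbrev M2 : Type := Matrix (Fin 2) (Fin 2) ℂ

/-- The matrix `B` of the Dirac system. -/
def B : M2 := !![0, 1; -1, 0]

/-- The canonical matrix potential `Q = (u, v; v, -u)`. -/
def potential (u v : ℝ → ℂ) (x : ℝ) : M2 := !![u x, v x; v x, -(u x)]

/-- `U` is the matrix solution on `[0, b]` of `B U' + Q U = l U` with `U 0 = I`. -/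
def IsMatrixSolution (b : ℝ) (Q : ℝ → M2) (l : ℂ) (U : ℝ → M2) : Prop :=
  U 0 = 1 ∧ ∃ U' : ℝ → M2, ∀ x ∈ Set.Icc 0 b,
    HasDerivWithinAt U (U' x) (Set.Icc 0 b) x ∧ B * U' x + Q x * U x = l • U x

/-- The matrix solution for the zero potential. -/
def U0 (l : ℂ) (x : ℝ) : M2 :=
  !![Complex.cos (l * x), -Complex.sin (l * x); Complex.sin (l * x), Complex.cos (l * x)]

/-- The closed triangle `Ω⁺ = {(x, t) : 0 ≤ x ≤ b, |t| ≤ x}`. -/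
def triangle (b : ℝ) : Set (ℝ × ℝ) := {z | 0 ≤ z.1 ∧ z.1 ≤ b ∧ |z.2| ≤ z.1}

/-- `K` is the integral kernel of the transmutation operator
`Y ↦ Y(x) + ∫_{-x}^{x} K(x,t) Y(t) dt`: a function that is `C¹` on the closed triangle
(up to the boundary) and solves there the Goursat problem
`B K_x + K_t B = -Q K`, `B K(x,x) - K(x,x) B = -Q(x)`, `B K(x,-x) + K(x,-x) B = 0`. -/
structure IsTransmutationKernel (b : ℝ) (Q : ℝ → M2) (K : ℝ × ℝ → M2) : Prop where
  contDiffOn : ContDiffOn ℝ 1 K (triangle b)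
  pde : ∀ z ∈ triangle b,
    B * fderivWithin ℝ K (triangle b) z (1, 0) + fderivWithin ℝ K (triangle b) z (0, 1) * B
      = -(Q z.1 * K z)
  goursat_diag : ∀ x ∈ Set.Icc 0 b, B * K (x, x) - K (x, x) * B = -Q x
  goursat_antidiag : ∀ x ∈ Set.Icc 0 b, B * K (x, -x) + K (x, -x) * B = 0

/-- The partial derivative `∂_t^m K` on the closed triangle (the `m`-th iterated derivative
relative to the triangle, evaluated on the vectors `(0,1), …, (0,1)`). -/
def partialT (b : ℝ) (m : ℕ) (K : ℝ × ℝ → M2) (z : ℝ × ℝ) : M2 :=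
  iteratedFDerivWithin ℝ m K (triangle b) z (fun _ => (0, 1))

/-- The Legendre polynomial `P_n`, by Rodrigues' formula. -/
def legendre (n : ℕ) : Polynomial ℝ :=
  Polynomial.C (1 / (2 ^ n * (n.factorial : ℝ))) *
    Polynomial.derivative^[n] ((Polynomial.X ^ 2 - 1) ^ n)

/-- The Fourier–Legendre coefficient
`K_n(x) = (2n+1)/2 ∫_{-x}^{x} K(x,t) P_n(t/x) dt`, for which
`K(x,t) = ∑ (1/x) K_n(x) P_n(t/x)`. -/
def coeff (K : ℝ × ℝ → M2) (n : ℕ) (x : ℝ) : M2 :=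
  ((2 * n + 1 : ℝ) / 2) • ∫ t in (-x)..x, (legendre n).eval (t / x) • K (x, t)

/-- The spherical Bessel function of the first kind `j_n`, by its everywhere convergent
power series `j_n(z) = ∑_k (-1)^k z^(2k+n) / (2^k k! (2n+2k+1)!!)`. -/
def sphericalBessel (n : ℕ) (z : ℂ) : ℂ :=
  ∑' k : ℕ, (-1) ^ k * z ^ (2 * k + n) /
    (2 ^ k * (k.factorial : ℂ) * (Nat.doubleFactorial (2 * n + 2 * k + 1) : ℂ))

/-- The coefficient of `j_n(l x)` in the Neumann series of Bessel functions:
`2 (-1)^(n/2) K_n(x)` for even `n` and `2 (-1)^((n+1)/2) K_n(x) B` for odd `n`. -/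
def coeffTilde (K : ℝ × ℝ → M2) (n : ℕ) (x : ℝ) : M2 :=
  if Even n then (2 * (-1 : ℂ) ^ (n / 2)) • coeff K n x
  else (2 * (-1 : ℂ) ^ ((n + 1) / 2)) • (coeff K n x * B)

/-- The `N`-th partial sum `U^N(l, x)` of the Neumann series of Bessel functions. -/
def partialSum (K : ℝ × ℝ → M2) (N : ℕ) (l : ℂ) (x : ℝ) : M2 :=
  U0 l x + ∑ n ∈ Finset.range (N + 1), sphericalBessel n (l * x) • coeffTilde K n x

/-- `ε_N(x) = C M x^(p+1) / N^(p+1/2)`. -/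
def epsilon (C M : ℝ) (p N : ℕ) (x : ℝ) : ℝ :=
  C * M * x ^ (p + 1) / (N : ℝ) ^ ((p : ℝ) + 1 / 2)

end

end DiracNSBF

/-! The proof rests on the transmutation formula `U(λ,x) = U0(λ,x) + ∫_{-x}^{x} K(x,t) U0(λ,t) dt`.
Integrating `P_n(t/x)` against `U0` over `[-x,x]` produces `j_n(λx)` (`integral_legendre_smul_U0`),
so `U^N` is the same formula with `K(x,·)` replaced by its truncated Fourier–Legendre series
(`partialSum_eq`). The error is therefore the integral of (kernel minus truncation) times `U0`.
Since `‖U0(λ,t)‖ ≤ exp(|Im λ||t|)` (`norm_U0_le`), both bounds follow from one estimate, uniform in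
`t`: the truncation error of the kernel is at most `ε_N(x)`.

That estimate is about scalar functions on `[-1,1]`: matrices are tested by real linear functionals,
and `s ↦ K(x,xs)` has `(p+1)`-st derivative `x^(p+1) ∂_t^(p+1) K`. Integration by parts gives
`(2n+3) c_{n+1}(f) = c_n(f') - c_{n+2}(f')` for the Legendre moments `c_n`. So each of `p`
derivatives gains a factor `1/N` in the `L²` size of the tail (`tail_lenergy_le`). The last
derivative passes from `L²` to the sup norm and gains `N^(-1/2)`: summation by parts trades `P_n`
for `P_{n+2} - P_n`, which is `O(n^(-1/2))` on all of `[-1,1]`, and Cauchy–Schwarz then converges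
(`abs_lsum_sub_le`).

The kernel itself comes from splitting `M2` into the parts commuting and anticommuting with `B`. As
`Q` anticommutes with `B`, in the coordinates `((x+t)/2, (x-t)/2)` the Goursat problem becomes `∂_1
K₁ = BQ K₂`, `∂_2 K₂ = BQ K₁` with `K₁ = 0` on one axis and `K₂ = BQ/2` on the other. After
extending `Q` to the line, a contraction in an exponentially weighted norm solves it on the plane,
the equations bootstrap its smoothness, and uniqueness on the triangle identifies any given kernel
with this one. Uniqueness for the linear ODE identifies `U` with the transmuted `U0`. -/

namespace DiracNSBF

/-! ### Legendre polynomials: recurrences and pointwise bounds -/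

section Legendre

open Polynomial

/-- The normalising factor of Rodrigues' formula. -/
noncomputable def rodriguesConst (n : ℕ) : ℝ := 1 / (2 ^ n * (n.factorial : ℝ))

lemma rodriguesConst_succ (n : ℕ) :
    rodriguesConst (n + 1) * (2 * ((n : ℝ) + 1)) = rodriguesConst n := by
  have : (n.factorial : ℝ) ≠ 0 := by exact_mod_cast n.factorial_ne_zero
  simp only [rodriguesConst, Nat.factorial_succ, Nat.cast_mul, Nat.cast_add, Nat.cast_one, pow_succ]
  field_simp

lemma legendre_def (n : ℕ) :
    legendre n = C (rodriguesConst n) * derivative^[n] ((X ^ 2 - 1) ^ n) := rfl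

lemma legendre_zero : legendre 0 = 1 := by
  simp [legendre]

lemma legendre_one : legendre 1 = X := by
  have : (C 2⁻¹ * (1 + 1) : ℝ[X]) = 1 := by
    rw [show (1 + 1 : ℝ[X]) = C 2 by rw [map_ofNat]; norm_num, ← C_mul]
    norm_num
  simp [legendre, ← mul_assoc, this]

lemma derivative_sq_sub_one_pow (n : ℕ) :
    derivative ((X ^ 2 - 1 : ℝ[X]) ^ (n + 1)) =
      C (2 * ((n : ℝ) + 1)) * (X * (X ^ 2 - 1) ^ n) := by
  rw [derivative_pow_succ]
  simp only [derivative_sub, derivative_X_pow, derivative_one, map_mul, map_add, map_ofNat,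
    map_natCast, map_one]
  norm_num
  ring

lemma iterate_derivative_X_mul' (n : ℕ) (f : ℝ[X]) :
    derivative^[n + 1] (X * f) = X * derivative^[n + 1] f + C ((n : ℝ) + 1) * derivative^[n] f := by
  induction n with
  | zero => simp [add_comm]
  | succ n ih =>
    rw [Function.iterate_succ_apply', ih]
    simp only [derivative_mul, derivative_X,
      Function.iterate_succ_apply', map_add, map_natCast, map_one, Nat.cast_add, Nat.cast_one,
      derivative_natCast, derivative_one]
    ring

/-- One differentiation of `(X²-1)^(n+1)` exposes a factor `X`, for which the Leibniz formula has
only two terms. -/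
lemma derivative_legendre_succ_X (n : ℕ) :
    derivative (legendre (n + 1)) =
      X * derivative (legendre n) + C ((n : ℝ) + 1) * legendre n := by
  have h : derivative^[n + 1] (derivative ((X ^ 2 - 1 : ℝ[X]) ^ (n + 1))) =
      C (2 * ((n : ℝ) + 1)) * (X * derivative^[n + 1] ((X ^ 2 - 1 : ℝ[X]) ^ n) +
        C ((n : ℝ) + 1) * derivative^[n] ((X ^ 2 - 1 : ℝ[X]) ^ n)) := by
    rw [derivative_sq_sub_one_pow, iterate_derivative_C_mul, iterate_derivative_X_mul']
  rw [legendre_def, legendre_def, derivative_C_mul, ← Function.iterate_succ_apply' derivative,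
    Function.iterate_succ_apply derivative, h, ← rodriguesConst_succ n, derivative_C_mul,
    Function.iterate_succ_apply']
  simp only [map_mul, map_add, map_ofNat, map_natCast, map_one]
  ring

/-- Differentiate `(X²-1)^(n+2)` twice and write `X² = (X²-1) + 1`; the remaining `n+1` derivatives
give the two Rodrigues formulas on the right. -/
lemma derivative_legendre_add_two (n : ℕ) :
    derivative (legendre (n + 2)) =
      derivative (legendre n) + C (2 * (n : ℝ) + 3) * legendre (n + 1) := by
  have h2 : derivative (derivative ((X ^ 2 - 1 : ℝ[X]) ^ (n + 2))) =
      C (2 * ((n : ℝ) + 2)) * (C (2 * (n : ℝ) + 3) * (X ^ 2 - 1) ^ (n + 1) +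
        C (2 * ((n : ℝ) + 1)) * (X ^ 2 - 1) ^ n) := by
    have := derivative_sq_sub_one_pow (n + 1)
    rw [show n + 2 = n + 1 + 1 from rfl, this, derivative_C_mul, derivative_mul,
      derivative_sq_sub_one_pow]
    simp only [derivative_X, map_mul, map_add, map_ofNat, map_natCast, map_one, Nat.cast_add,
      Nat.cast_one]
    ring
  have h : derivative^[n + 1] (derivative (derivative ((X ^ 2 - 1 : ℝ[X]) ^ (n + 2)))) =
      C (2 * ((n : ℝ) + 2)) *
        (C (2 * (n : ℝ) + 3) * derivative^[n + 1] ((X ^ 2 - 1 : ℝ[X]) ^ (n + 1)) +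
        C (2 * ((n : ℝ) + 1)) * derivative^[n + 1] ((X ^ 2 - 1 : ℝ[X]) ^ n)) := by
    rw [h2, iterate_derivative_C_mul, iterate_map_add, iterate_derivative_C_mul,
      iterate_derivative_C_mul]
  have c2 := rodriguesConst_succ (n + 1)
  push_cast at c2
  rw [legendre_def, legendre_def, legendre_def, derivative_C_mul, ← Function.iterate_succ_apply' derivative,
    Function.iterate_succ_apply derivative, Function.iterate_succ_apply derivative, h, ← rodriguesConst_succ n, ← c2,
    derivative_C_mul, ← Function.iterate_succ_apply' derivative n]
  simp only [map_mul, map_add, map_ofNat, map_natCast, map_one]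
  ring

lemma derivative_legendre_eq (n : ℕ) :
    derivative (legendre n) =
      X * derivative (legendre (n + 1)) - C ((n : ℝ) + 1) * legendre (n + 1) := by
  have h1 := derivative_legendre_succ_X (n + 1)
  rw [derivative_legendre_add_two n] at h1
  simp only [map_mul, map_add, map_ofNat, map_natCast, map_one, Nat.cast_add, Nat.cast_one] at h1 ⊢
  linear_combination h1

lemma legendre_ode_left (n : ℕ) (s : ℝ) :
    (1 - s ^ 2) * (derivative (legendre (n + 1))).eval s =
      (n + 1) * ((legendre n).eval s - s * (legendre (n + 1)).eval s) := by
  have h1 := congrArg (eval s) (derivative_legendre_eq n)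
  have h2 := congrArg (eval s) (derivative_legendre_succ_X n)
  simp only [eval_sub, eval_add, eval_mul, eval_C, eval_X] at h1 h2
  linear_combination h2 + s * h1

lemma legendre_ode_right (n : ℕ) (s : ℝ) :
    (1 - s ^ 2) * (derivative (legendre n)).eval s =
      (n + 1) * (s * (legendre n).eval s - (legendre (n + 1)).eval s) := by
  have h1 := congrArg (eval s) (derivative_legendre_eq n)
  have h2 := congrArg (eval s) (derivative_legendre_succ_X n)
  simp only [eval_sub, eval_add, eval_mul, eval_C, eval_X] at h1 h2
  linear_combination s * h2 + h1

/-- Two expressions for `(1-s²) P_{n+1}'`, one through `P_n` and one through `P_{n+2}`, are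
compared. -/
lemma legendre_bonnet (n : ℕ) (s : ℝ) :
    (n + 2) * (legendre (n + 2)).eval s =
      (2 * n + 3) * s * (legendre (n + 1)).eval s - (n + 1) * (legendre n).eval s := by
  have h1 := legendre_ode_left n s
  have h2 := legendre_ode_right (n + 1) s
  push_cast at h2
  linear_combination h2 - h1

lemma one_sub_sq_mul_derivative_legendre (n : ℕ) (s : ℝ) :
    (2 * n + 3) * ((1 - s ^ 2) * (derivative (legendre (n + 1))).eval s) =
      -((n + 1) * (n + 2)) * ((legendre (n + 2)).eval s - (legendre n).eval s) := by
  have h1 := legendre_ode_left n s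
  have h2 := legendre_ode_right (n + 1) s
  push_cast at h2
  linear_combination (n + 2 : ℝ) * h1 + (n + 1 : ℝ) * h2

lemma legendre_eval_one (n : ℕ) : (legendre n).eval 1 = 1 := by
  induction n with
  | zero => simp [legendre_zero]
  | succ n ih =>
    have h := legendre_ode_right n 1
    have hn : (n + 1 : ℝ) ≠ 0 := by positivity
    have : (n + 1 : ℝ) * (1 - (legendre (n + 1)).eval 1) = 0 := by
      rw [ih] at h; linear_combination -h
    have := (mul_eq_zero.1 this).resolve_left hn
    linarith

lemma legendre_eval_neg_one (n : ℕ) : (legendre n).eval (-1) = (-1) ^ n := by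
  induction n with
  | zero => simp [legendre_zero]
  | succ n ih =>
    have h := legendre_ode_right n (-1)
    have hn : (n + 1 : ℝ) ≠ 0 := by positivity
    have : (n + 1 : ℝ) * (-(-1) ^ n - (legendre (n + 1)).eval (-1)) = 0 := by
      rw [ih] at h; linear_combination -h
    have := (mul_eq_zero.1 this).resolve_left hn
    rw [pow_succ]; linarith

/-- A function on `[-1, 1]` whose derivative has the sign of `s` is largest at the endpoints. -/
lemma le_max_endpoints {f f' : ℝ → ℝ} (hf : ∀ s, HasDerivAt f (f' s) s)
    (hpos : ∀ s ∈ Set.Icc (0 : ℝ) 1, 0 ≤ f' s) (hneg : ∀ s ∈ Set.Icc (-1 : ℝ) 0, f' s ≤ 0)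
    {s : ℝ} (hs : s ∈ Set.Icc (-1 : ℝ) 1) : f 0 ≤ f s ∧ f s ≤ max (f (-1)) (f 1) := by
  have hc : Continuous f := continuous_iff_continuousAt.2 fun s => (hf s).continuousAt
  have hd : ∀ s, deriv f s = f' s := fun s => (hf s).deriv
  have m1 : MonotoneOn f (Set.Icc 0 1) := by
    refine monotoneOn_of_deriv_nonneg (convex_Icc 0 1) hc.continuousOn
      (fun s _ => (hf s).differentiableAt.differentiableWithinAt) fun s hs => ?_
    rw [hd]; exact hpos s (interior_subset hs)
  have m2 : AntitoneOn f (Set.Icc (-1) 0) := by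
    refine antitoneOn_of_deriv_nonpos (convex_Icc (-1) 0) hc.continuousOn
      (fun s _ => (hf s).differentiableAt.differentiableWithinAt) fun s hs => ?_
    rw [hd]; exact hneg s (interior_subset hs)
  rcases le_total 0 s with h | h
  · exact ⟨m1 ⟨le_rfl, zero_le_one⟩ ⟨h, hs.2⟩ h,
      le_max_of_le_right (m1 ⟨h, hs.2⟩ ⟨zero_le_one, le_rfl⟩ hs.2)⟩
  · exact ⟨m2 ⟨hs.1, h⟩ ⟨by norm_num, le_rfl⟩ h,
      le_max_of_le_left (m2 ⟨le_rfl, by norm_num⟩ ⟨hs.1, h⟩ hs.1)⟩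

/-- The Legendre differential equation. -/
lemma legendre_ode (n : ℕ) (s : ℝ) :
    (1 - s ^ 2) * (derivative (derivative (legendre n))).eval s =
      2 * s * (derivative (legendre n)).eval s - n * (n + 1) * (legendre n).eval s := by
  have h0 : (1 - X ^ 2) * derivative (legendre n) =
      C ((n : ℝ) + 1) * (X * legendre n - legendre (n + 1)) := by
    refine Polynomial.funext fun s => ?_
    simpa using legendre_ode_right n s
  have h1 := congrArg (fun q => eval s (derivative q)) h0
  have h2 := congrArg (eval s) (derivative_legendre_succ_X n)
  simp only [derivative_mul, derivative_sub, derivative_one, derivative_X_pow, derivative_C,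
    derivative_X, eval_sub, eval_add, eval_mul, eval_C, eval_X, eval_one, eval_pow, eval_zero,
    Nat.cast_ofNat, map_ofNat, eval_ofNat] at h1 h2
  norm_num at h1
  linear_combination h1 + (-(n : ℝ) - 1) * h2

/-- Sonin's argument: by the Legendre equation `n(n+1) P_n² + (1-t²) P_n'²` has derivative `2t
P_n'²`, so it is largest at `±1`, where it equals `n(n+1)`. -/
lemma abs_legendre_le_one (n : ℕ) {s : ℝ} (hs : s ∈ Set.Icc (-1 : ℝ) 1) :
    |(legendre n).eval s| ≤ 1 := by
  rcases Nat.eq_zero_or_pos n with rfl | hn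
  · simp [legendre_zero]
  have hn' : (0 : ℝ) < n * (n + 1) := by positivity
  let f : ℝ → ℝ := fun t => n * (n + 1) * (legendre n).eval t ^ 2 +
    (1 - t ^ 2) * (derivative (legendre n)).eval t ^ 2
  have hf : ∀ t, HasDerivAt f (2 * t * (derivative (legendre n)).eval t ^ 2) t := by
    intro t
    have h1 := (((legendre n).hasDerivAt t).pow 2).const_mul ((n : ℝ) * (n + 1))
    have h2 := (((hasDerivAt_id t).pow 2).const_sub 1).mul
      (((derivative (legendre n)).hasDerivAt t).pow 2)
    refine (h1.add h2).congr_deriv ?_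
    have h := legendre_ode n t
    simp
    linear_combination 2 * (derivative (legendre n)).eval t * h
  have h := (le_max_endpoints hf (fun t ht => by have := ht.1; positivity)
    (fun t ht => mul_nonpos_of_nonpos_of_nonneg (by linarith [ht.2]) (sq_nonneg _)) hs).2
  have e1 : f 1 = n * (n + 1) := by simp [f, legendre_eval_one]
  have e2 : f (-1) = n * (n + 1) := by simp [f, legendre_eval_neg_one, ← pow_mul, mul_comm n 2]
  rw [e1, e2, max_self] at h
  have h3 : 0 ≤ (1 - s ^ 2) * (derivative (legendre n)).eval s ^ 2 :=
    mul_nonneg (by nlinarith [hs.1, hs.2]) (sq_nonneg _)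
  have h4 : n * (n + 1) * (legendre n).eval s ^ 2 ≤ n * (n + 1) * 1 := by
    simp only [f] at h; linarith
  have := le_of_mul_le_mul_left h4 hn'
  exact abs_le_one_iff_mul_self_le_one.2 (by nlinarith)

/-- Bonnet's recurrence at `0` links `P_{n+2}(0)` to `P_n(0)`, and `(n+1)(n+3) ≤ (n+2)²` makes the
left side nonincreasing along each parity class. -/
lemma legendre_eval_zero_sq (n : ℕ) :
    (n + 1) * (legendre n).eval 0 ^ 2 ≤ 1 := by
  induction n using Nat.twoStepInduction with
  | zero => simp [legendre_zero]
  | one => simp [legendre_one]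
  | more n ih _ =>
    have h := legendre_bonnet n 0
    simp only [mul_zero, zero_mul, zero_sub] at h
    have h2 : ((n : ℝ) + 2) ^ 2 * (legendre (n + 2)).eval 0 ^ 2 =
        (n + 1) ^ 2 * (legendre n).eval 0 ^ 2 := by
      rw [← mul_pow, h]; ring
    have h3 : ((n : ℝ) + 2) ^ 2 * ((n + 2 + 1) * (legendre (n + 2)).eval 0 ^ 2) ≤
        ((n : ℝ) + 2) ^ 2 * 1 := by
      have : ((n : ℝ) + 2) ^ 2 * ((n + 2 + 1) * (legendre (n + 2)).eval 0 ^ 2) =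
        (n + 1) * (n + 3) * ((n + 1) * (legendre n).eval 0 ^ 2) := by
        linear_combination (n + 3 : ℝ) * h2
      rw [this]
      have : ((n : ℝ) + 1) * (n + 3) * ((n + 1) * (legendre n).eval 0 ^ 2) ≤
        ((n : ℝ) + 1) * (n + 3) * 1 := by gcongr
      nlinarith
    push_cast
    exact le_of_mul_le_mul_left h3 (by positivity)

/-- Consecutive Legendre polynomials of the same parity differ by `O(n^{-1/2})`. -/
lemma legendre_sub_sq_le (n : ℕ) {s : ℝ} (hs : s ∈ Set.Icc (-1 : ℝ) 1) :
    ((legendre (n + 2)).eval s - (legendre n).eval s) ^ 2 ≤ 8 / (n + 1) := by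
  set k : ℝ := (n + 1) * (n + 2) with hk
  have hk0 : 0 < k := by positivity
  let D : ℝ → ℝ := fun t => (legendre (n + 2)).eval t - (legendre n).eval t
  have hD : ∀ t, HasDerivAt D ((2 * n + 3) * (legendre (n + 1)).eval t) t := by
    intro t
    refine (((legendre (n + 2)).hasDerivAt t).sub ((legendre n).hasDerivAt t)).congr_deriv ?_
    have h := congrArg (eval t) (derivative_legendre_add_two n)
    simp only [eval_add, eval_mul, eval_C] at h
    linear_combination h
  -- Sonin's function again, with the opposite sign: `D = P_{n+2} - P_n` satisfies `(1-t²) D'' = -k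
  -- D`, so `k D² + (1-t²) D'²` is largest at `0`, where the values of the Legendre polynomials are
  -- controlled.
  let f : ℝ → ℝ := fun t => -(k * D t ^ 2 +
    (1 - t ^ 2) * ((2 * n + 3) * (legendre (n + 1)).eval t) ^ 2)
  have hf : ∀ t, HasDerivAt f (2 * t * ((2 * n + 3) * (legendre (n + 1)).eval t) ^ 2) t := by
    intro t
    have h1 := ((hD t).pow 2).const_mul k
    have h2 := (((hasDerivAt_id t).pow 2).const_sub 1).mul
      ((((legendre (n + 1)).hasDerivAt t).const_mul (2 * (n : ℝ) + 3)).pow 2)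
    refine (h1.add h2).neg.congr_deriv ?_
    have h := one_sub_sq_mul_derivative_legendre n t
    simp [D, hk]
    linear_combination (-2 * (2 * (n : ℝ) + 3) * (legendre (n + 1)).eval t) * h
  have h := (le_max_endpoints hf (fun t ht => by have := ht.1; positivity)
    (fun t ht => mul_nonpos_of_nonpos_of_nonneg (by linarith [ht.2]) (sq_nonneg _)) hs).1
  have h3 : 0 ≤ (1 - s ^ 2) * ((2 * n + 3) * (legendre (n + 1)).eval s) ^ 2 :=
    mul_nonneg (by nlinarith [hs.1, hs.2]) (sq_nonneg _)
  have z1 := legendre_eval_zero_sq n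
  have z2 := legendre_eval_zero_sq (n + 1)
  push_cast at z2
  have hb := legendre_bonnet n 0
  have e0 : D 0 ^ 2 * (n + 2) ^ 2 = (2 * n + 3) ^ 2 * (legendre n).eval 0 ^ 2 := by
    have : D 0 * (n + 2) = -((2 * n + 3) * (legendre n).eval 0) := by
      simp only [D]; linear_combination hb
    rw [← mul_pow, this]; ring
  have h4 : k * D s ^ 2 ≤ k * D 0 ^ 2 + ((2 * n + 3) * (legendre (n + 1)).eval 0) ^ 2 := by
    simp only [f] at h; linarith
  have h5 : k * D s ^ 2 * (n + 2) ≤ 2 * (2 * n + 3) ^ 2 := by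
    have a1 : k * D 0 ^ 2 * (n + 2) = (2 * n + 3) ^ 2 * ((n + 1) * (legendre n).eval 0 ^ 2) := by
      linear_combination (n + 1 : ℝ) * e0
    have a2 : (2 * (n : ℝ) + 3) ^ 2 * ((n + 1) * (legendre n).eval 0 ^ 2) ≤
      (2 * n + 3) ^ 2 * 1 := by gcongr
    have a3 : (2 * (n : ℝ) + 3) ^ 2 * ((n + 1 + 1) * (legendre (n + 1)).eval 0 ^ 2) ≤
      (2 * n + 3) ^ 2 * 1 := by gcongr
    have a4 := mul_le_mul_of_nonneg_right h4 (show (0 : ℝ) ≤ n + 2 by positivity)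
    nlinarith
  change D s ^ 2 ≤ _
  rw [le_div_iff₀ (by positivity)]
  -- The constant 8 comes from `2(2n+3)² ≤ 8(n+2)²`.
  have h6 : (n + 2 : ℝ) ^ 2 * (D s ^ 2 * (n + 1)) ≤ (n + 2) ^ 2 * 8 := by
    have : (n + 2 : ℝ) ^ 2 * (D s ^ 2 * (n + 1)) = k * D s ^ 2 * (n + 2) := by rw [hk]; ring
    rw [this]
    nlinarith [Nat.cast_nonneg (α := ℝ) n]
  exact le_of_mul_le_mul_left h6 (by positivity)

end Legendre

end DiracNSBF

namespace DiracNSBF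

/-! ### Orthogonality, norms and span of the Legendre polynomials; beta integrals -/

section Orthogonality

open Polynomial

lemma integral_derivative_mul (p q : ℝ[X]) :
    ∫ s in (-1 : ℝ)..1, (derivative p).eval s * q.eval s =
      p.eval 1 * q.eval 1 - p.eval (-1) * q.eval (-1) -
        ∫ s in (-1 : ℝ)..1, p.eval s * (derivative q).eval s := by
  have h := intervalIntegral.integral_mul_deriv_eq_deriv_mul (a := -1) (b := 1)
    (fun s _ => q.hasDerivAt s) (fun s _ => p.hasDerivAt s)
    ((derivative q).continuous.intervalIntegrable _ _)
    ((derivative p).continuous.intervalIntegrable _ _)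
  simp only [mul_comm (eval _ (derivative p)), mul_comm (eval _ p)]
  exact h

/-- Repeated integration by parts. There are no boundary terms, because a derivative of order below
`n` of `(X²-1)^n` still contains a factor `X²-1`. -/
lemma integral_iterate_derivative_mul (n : ℕ) (g : ℝ[X]) : ∀ j ≤ n,
    ∫ s in (-1 : ℝ)..1, (derivative^[n] ((X ^ 2 - 1) ^ n)).eval s * g.eval s =
      (-1) ^ j * ∫ s in (-1 : ℝ)..1,
        (derivative^[n - j] ((X ^ 2 - 1) ^ n)).eval s * (derivative^[j] g).eval s := by
  intro j
  induction j with
  | zero => simp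
  | succ j ih =>
    intro hj
    have hz : ∀ t : ℝ, t ^ 2 = 1 →
        (derivative^[n - (j + 1)] ((X ^ 2 - 1 : ℝ[X]) ^ n)).eval t = 0 := by
      intro t ht
      obtain ⟨r, hr⟩ := pow_sub_dvd_iterate_derivative_pow (X ^ 2 - 1 : ℝ[X]) n (n - (j + 1))
      rw [hr, show n - (n - (j + 1)) = j + 1 by omega]
      simp [ht]
    rw [ih (by omega), show n - j = n - (j + 1) + 1 by omega, Function.iterate_succ_apply',
      integral_derivative_mul, hz 1 (by norm_num), hz (-1) (by norm_num),
      ← Function.iterate_succ_apply' derivative]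
    ring

lemma integral_legendre_mul (n : ℕ) (g : ℝ[X]) :
    ∫ s in (-1 : ℝ)..1, (legendre n).eval s * g.eval s =
      rodriguesConst n * ∫ s in (-1 : ℝ)..1, (1 - s ^ 2) ^ n * (derivative^[n] g).eval s := by
  have h := integral_iterate_derivative_mul n g n le_rfl
  simp only [legendre_def, eval_mul, eval_C, mul_assoc, intervalIntegral.integral_const_mul]
  rw [h, ← intervalIntegral.integral_const_mul]
  congr 1
  refine intervalIntegral.integral_congr fun s _ => ?_
  simp only [Nat.sub_self, Function.iterate_zero, id, eval_pow, eval_sub, eval_X, eval_one]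
  rw [← mul_assoc, ← mul_pow]
  ring

lemma integral_legendre_mul_of_natDegree_lt {n : ℕ} {g : ℝ[X]} (h : g.natDegree < n) :
    ∫ s in (-1 : ℝ)..1, (legendre n).eval s * g.eval s = 0 := by
  rw [integral_legendre_mul, iterate_derivative_eq_zero h]
  simp

lemma natDegree_legendre_le (n : ℕ) : (legendre n).natDegree ≤ n := by
  rw [legendre_def]
  refine (natDegree_C_mul_le _ _).trans ((natDegree_iterate_derivative _ _).trans ?_)
  have : ((X ^ 2 - 1 : ℝ[X]) ^ n).natDegree ≤ n * 2 :=
    natDegree_pow_le.trans (Nat.mul_le_mul_left _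
      (natDegree_X_pow_sub_C (n := 2) (r := (1 : ℝ))).le)
  omega

lemma integral_legendre_mul_legendre_of_ne {n m : ℕ} (h : n ≠ m) :
    ∫ s in (-1 : ℝ)..1, (legendre n).eval s * (legendre m).eval s = 0 := by
  rcases lt_or_gt_of_ne h with h | h
  · simp only [mul_comm (eval _ (legendre n))]
    exact integral_legendre_mul_of_natDegree_lt ((natDegree_legendre_le n).trans_lt h)
  · exact integral_legendre_mul_of_natDegree_lt ((natDegree_legendre_le m).trans_lt h)

/-- For positive index, integrate `P_{n+1}' · X P_{n+1}` by parts. As `X P_{n+1}' = P_n' + (n+1)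
P_{n+1}` and `P_n'` is orthogonal to `P_{n+1}` by degree, the norm `I` satisfies `2(n+1) I = 2 - I`.
-/
lemma integral_legendre_sq (n : ℕ) :
    ∫ s in (-1 : ℝ)..1, (legendre n).eval s * (legendre n).eval s = 2 / (2 * n + 1) := by
  cases n with
  | zero => norm_num [legendre_zero]
  | succ n =>
    have h1 := integral_derivative_mul (legendre (n + 1)) (X * legendre (n + 1))
    have h2 : ∀ s, (derivative (legendre (n + 1))).eval s * (X * legendre (n + 1)).eval s =
        (legendre (n + 1)).eval s * (derivative (legendre n)).eval s +
        (n + 1) * ((legendre (n + 1)).eval s * (legendre (n + 1)).eval s) := by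
      intro s
      have h := congrArg (eval s) (derivative_legendre_eq n)
      simp only [eval_sub, eval_mul, eval_C, eval_X] at h ⊢
      rw [h]; ring
    have h3 : ∀ s, (legendre (n + 1)).eval s * (derivative (X * legendre (n + 1))).eval s =
        (legendre (n + 1)).eval s * (legendre (n + 1)).eval s +
        (derivative (legendre (n + 1))).eval s * (X * legendre (n + 1)).eval s := by
      intro s
      simp only [derivative_mul, derivative_X, eval_add, eval_mul, eval_one, eval_X]
      ring
    have hc : ∀ p q : ℝ[X], IntervalIntegrable (fun s => p.eval s * q.eval s)
        MeasureTheory.volume (-1) 1 :=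
      fun p q => (p.continuous.mul q.continuous).intervalIntegrable _ _
    have h4 : ∫ s in (-1 : ℝ)..1, (legendre (n + 1)).eval s * (derivative (legendre n)).eval s = 0 :=
      integral_legendre_mul_of_natDegree_lt
        ((natDegree_derivative_le _).trans_lt (by have := natDegree_legendre_le n; omega))
    simp only [h3] at h1
    rw [intervalIntegral.integral_add (hc _ _) (hc _ _)] at h1
    simp only [h2] at h1
    rw [intervalIntegral.integral_add (hc _ _) ((hc _ _).const_mul _), h4,
      intervalIntegral.integral_const_mul] at h1
    simp only [eval_mul, eval_X, legendre_eval_one, legendre_eval_neg_one] at h1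
    have h5 : ((-1 : ℝ) ^ (n + 1)) * (-1) ^ (n + 1) = 1 := by rw [← mul_pow]; norm_num
    rw [eq_div_iff (by positivity)]
    push_cast
    linear_combination h1 + h5

/-- The span contains `1` and, by Bonnet's recurrence, is stable under multiplication by `X`. -/
lemma mem_span_legendre (q : ℝ[X]) : q ∈ Submodule.span ℝ (Set.range legendre) := by
  set S := Submodule.span ℝ (Set.range legendre)
  have hL : ∀ n, legendre n ∈ S := fun n => Submodule.subset_span ⟨n, rfl⟩
  have hX : ∀ q ∈ S, X * q ∈ S := by
    intro q hq
    induction hq using Submodule.span_induction with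
    | mem q hq =>
      obtain ⟨n, rfl⟩ := hq
      cases n with
      | zero =>
        rw [legendre_zero, mul_one, ← legendre_one]; exact hL 1
      | succ n =>
        have : X * legendre (n + 1) = (((n : ℝ) + 2) / (2 * n + 3)) • legendre (n + 2) +
            (((n : ℝ) + 1) / (2 * n + 3)) • legendre n := by
          refine Polynomial.funext fun s => ?_
          have h := legendre_bonnet n s
          simp only [eval_mul, eval_X, eval_add, eval_smul, smul_eq_mul]
          field_simp
          linear_combination -h
        rw [this]
        exact S.add_mem (S.smul_mem _ (hL _)) (S.smul_mem _ (hL _))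
    | zero => simp
    | add a b _ _ ha hb => rw [mul_add]; exact S.add_mem ha hb
    | smul c a _ ha => rw [mul_smul_comm]; exact S.smul_mem _ ha
  have hXn : ∀ n : ℕ, (X : ℝ[X]) ^ n ∈ S := by
    intro n
    induction n with
    | zero => rw [pow_zero, ← legendre_zero]; exact hL 0
    | succ n ih => rw [pow_succ']; exact hX _ ih
  induction q using Polynomial.induction_on' with
  | add a b ha hb => exact S.add_mem ha hb
  | monomial n a =>
    rw [← C_mul_X_pow_eq_monomial, ← smul_eq_C_mul]
    exact S.smul_mem _ (hXn n)

lemma integral_one_sub_sq_pow_succ (n k : ℕ) :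
    (2 * k + 2 * n + 3 : ℝ) * ∫ s in (-1 : ℝ)..1, (1 - s ^ 2) ^ (n + 1) * s ^ (2 * k) =
      (2 * n + 2) * ∫ s in (-1 : ℝ)..1, (1 - s ^ 2) ^ n * s ^ (2 * k) := by
  have h1 := integral_derivative_mul (X ^ (2 * k + 1)) ((1 - X ^ 2) ^ (n + 1))
  have hc : ∀ p : ℝ[X], IntervalIntegrable (fun s => p.eval s) MeasureTheory.volume (-1) 1 :=
    fun p => p.continuous.intervalIntegrable _ _
  have e1 : ∀ s : ℝ, eval s (derivative (X ^ (2 * k + 1))) * eval s ((1 - X ^ 2) ^ (n + 1)) =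
      (2 * k + 1) * ((1 - s ^ 2) ^ (n + 1) * s ^ (2 * k)) := by
    intro s
    simp
    ring
  have e2 : ∀ s : ℝ, eval s (X ^ (2 * k + 1)) * eval s (derivative ((1 - X ^ 2) ^ (n + 1))) =
      (2 * n + 2) * ((1 - s ^ 2) ^ (n + 1) * s ^ (2 * k)) -
      (2 * n + 2) * ((1 - s ^ 2) ^ n * s ^ (2 * k)) := by
    intro s
    simp [derivative_pow]
    ring
  have i1 := hc ((1 - X ^ 2) ^ (n + 1) * X ^ (2 * k))
  have i2 := hc ((1 - X ^ 2) ^ n * X ^ (2 * k))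
  simp only [eval_mul, eval_pow, eval_sub, eval_one, eval_X] at i1 i2
  simp only [e1, e2] at h1
  rw [intervalIntegral.integral_sub (i1.const_mul _) (i2.const_mul _),
    intervalIntegral.integral_const_mul, intervalIntegral.integral_const_mul,
    intervalIntegral.integral_const_mul] at h1
  norm_num at h1
  linear_combination h1

/-- The closed form is arranged so that the double factorial of the power series of `j_n` appears.
-/
lemma integral_one_sub_sq_pow (n k : ℕ) :
    ∫ s in (-1 : ℝ)..1, (1 - s ^ 2) ^ n * s ^ (2 * k) =
      2 ^ (n + 1) * n.factorial * (2 * k).factorial /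
        (2 ^ k * k.factorial * (Nat.doubleFactorial (2 * n + 2 * k + 1) : ℝ)) := by
  induction n with
  | zero =>
    have h : (((2 * k + 1).factorial : ℕ) : ℝ) =
        (2 * k + 1).doubleFactorial * (2 ^ k * k.factorial) := by
      rw [Nat.factorial_eq_mul_doubleFactorial, Nat.doubleFactorial_two_mul]; push_cast; ring
    have h' : (((2 * k + 1).factorial : ℕ) : ℝ) = (2 * k + 1) * (2 * k).factorial := by
      rw [Nat.factorial_succ]; push_cast; ring
    have : ∫ s in (-1 : ℝ)..1, s ^ (2 * k) = 2 / (2 * k + 1) := by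
      rw [integral_pow]
      norm_num [pow_succ]
    simp only [pow_zero, one_mul, this, mul_zero, zero_add, Nat.factorial_zero, Nat.cast_one,
      pow_one, mul_one]
    have h0 : (0 : ℝ) < (2 * k + 1).doubleFactorial := by exact_mod_cast Nat.doubleFactorial_pos _
    have h1 : (0 : ℝ) < k.factorial := by exact_mod_cast k.factorial_pos
    rw [div_eq_div_iff (by positivity) (by positivity)]
    linear_combination 2 * (h' - h)
  | succ n ih =>
    have h := integral_one_sub_sq_pow_succ n k
    rw [ih] at h
    have h0 : (0 : ℝ) < (2 * n + 2 * k + 1).doubleFactorial := by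
      exact_mod_cast Nat.doubleFactorial_pos _
    have h1 : (0 : ℝ) < k.factorial := by exact_mod_cast k.factorial_pos
    rw [show 2 * (n + 1) + 2 * k + 1 = (2 * n + 2 * k + 1) + 2 by ring, Nat.doubleFactorial_add_two,
      Nat.factorial_succ, eq_div_iff (by positivity)]
    have h2 : (2 * (k : ℝ) + 2 * n + 3) ≠ 0 := by positivity
    set I := ∫ s in (-1 : ℝ)..1, (1 - s ^ 2) ^ (n + 1) * s ^ (2 * k)
    have h3 : (2 * (k : ℝ) + 2 * n + 3) * I * (2 ^ k * k.factorial *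
        (2 * n + 2 * k + 1).doubleFactorial) =
        (2 * n + 2) * (2 ^ (n + 1) * n.factorial * (2 * k).factorial) := by
      rw [h]; field_simp
    push_cast
    linear_combination h3

end Orthogonality

end DiracNSBF

namespace DiracNSBF

/-! ### From Legendre polynomials to spherical Bessel functions -/

section Bessel

open Polynomial

lemma integral_one_sub_sq_pow_odd (n k : ℕ) :
    ∫ s in (-1 : ℝ)..1, (1 - s ^ 2) ^ n * s ^ (2 * k + 1) = 0 := by
  have h := intervalIntegral.integral_comp_neg (a := -1) (b := 1)
    (fun s : ℝ => (1 - s ^ 2) ^ n * s ^ (2 * k + 1))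
  have h2 : ∀ s : ℝ, (1 - (-s) ^ 2) ^ n * (-s) ^ (2 * k + 1) =
      -((1 - s ^ 2) ^ n * s ^ (2 * k + 1)) := by
    intro s
    rw [neg_sq, Odd.neg_pow ⟨k, rfl⟩]; ring
  simp only [h2, neg_neg, intervalIntegral.integral_neg] at h
  linarith

lemma integral_legendre_mul_pow (n m : ℕ) :
    ∫ s in (-1 : ℝ)..1, (legendre n).eval s * s ^ m =
      rodriguesConst n * (m.descFactorial n *
        ∫ s in (-1 : ℝ)..1, (1 - s ^ 2) ^ n * s ^ (m - n)) := by
  have h := integral_legendre_mul n (X ^ m)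
  simp only [eval_pow, eval_X] at h
  rw [h, iterate_derivative_X_pow_eq_natCast_mul,
    ← intervalIntegral.integral_const_mul (m.descFactorial n : ℝ)]
  congr 1
  refine intervalIntegral.integral_congr fun s _ => ?_
  simp
  ring

/-- Powers below `n` are killed by orthogonality, the others excluded here by parity. -/
lemma integral_legendre_mul_pow_of_notMem {n m : ℕ} (h : m ∉ Set.range fun k => n + 2 * k) :
    ∫ s in (-1 : ℝ)..1, (legendre n).eval s * s ^ m = 0 := by
  rw [integral_legendre_mul_pow]
  rcases lt_or_ge m n with hmn | hmn
  · rw [Nat.descFactorial_of_lt hmn]; simp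
  · obtain ⟨r, rfl⟩ := Nat.exists_eq_add_of_le hmn
    rcases Nat.even_or_odd' r with ⟨k, rfl | rfl⟩
    · exact absurd ⟨k, rfl⟩ h
    · rw [Nat.add_sub_cancel_left, integral_one_sub_sq_pow_odd]; simp

lemma integral_legendre_mul_pow_add (n k : ℕ) :
    (∫ s in (-1 : ℝ)..1, (legendre n).eval s * s ^ (n + 2 * k)) / (n + 2 * k).factorial =
      2 / (2 ^ k * k.factorial * (Nat.doubleFactorial (2 * n + 2 * k + 1) : ℝ)) := by
  rw [integral_legendre_mul_pow, Nat.add_sub_cancel_left, integral_one_sub_sq_pow, rodriguesConst]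
  have h := Nat.factorial_mul_descFactorial (Nat.le_add_right n (2 * k))
  rw [Nat.add_sub_cancel_left] at h
  have h' : ((2 * k).factorial : ℝ) * (n + 2 * k).descFactorial n = (n + 2 * k).factorial := by
    exact_mod_cast h
  rw [← h']
  have h0 : (0 : ℝ) < (2 * n + 2 * k + 1).doubleFactorial := by
    exact_mod_cast Nat.doubleFactorial_pos _
  have h1 : (0 : ℝ) < k.factorial := by exact_mod_cast k.factorial_pos
  have h2 : (0 : ℝ) < n.factorial := by exact_mod_cast n.factorial_pos
  have h3 : (0 : ℝ) < (2 * k).factorial := by exact_mod_cast (2 * k).factorial_pos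
  have h4 : (0 : ℝ) < (n + 2 * k).descFactorial n := by
    exact_mod_cast Nat.descFactorial_pos.2 (by omega)
  field_simp
  ring

lemma continuous_eval_real (q : ℝ[X]) : Continuous fun s => q.eval s := q.continuous

lemma hasSum_integral_legendre_mul_exp (n : ℕ) (w : ℂ) :
    HasSum (fun m : ℕ => w ^ m / m.factorial *
        ((∫ s in (-1 : ℝ)..1, (legendre n).eval s * s ^ m : ℝ) : ℂ))
      (∫ s in (-1 : ℝ)..1, (((legendre n).eval s : ℝ) : ℂ) * Complex.exp (w * s)) := by
  have hF : ∀ m : ℕ, w ^ m / m.factorial *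
        ((∫ s in (-1 : ℝ)..1, (legendre n).eval s * s ^ m : ℝ) : ℂ) =
      ∫ s in (-1 : ℝ)..1, (((legendre n).eval s : ℝ) : ℂ) * ((w * s) ^ m / m.factorial) := by
    intro m
    rw [← intervalIntegral.integral_ofReal, ← intervalIntegral.integral_const_mul]
    refine intervalIntegral.integral_congr fun s _ => ?_
    push_cast
    ring
  simp only [hF]
  have hc := continuous_eval_real (legendre n)
  refine intervalIntegral.hasSum_integral_of_dominated_convergence
    (fun m _ => ‖w‖ ^ m / m.factorial) (fun m => ?_) (fun m => ?_) ?_ ?_ ?_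
  · exact (by fun_prop : Continuous fun s : ℝ =>
      (((legendre n).eval s : ℝ) : ℂ) * ((w * s) ^ m / m.factorial)).aestronglyMeasurable
  · refine Filter.Eventually.of_forall fun s hs => ?_
    rw [Set.uIoc_of_le (by norm_num)] at hs
    have h1 := abs_legendre_le_one n (Set.Ioc_subset_Icc_self hs)
    have h2 : |s| ≤ 1 := abs_le.2 ⟨hs.1.le, hs.2⟩
    rw [norm_mul, norm_div, norm_pow, norm_mul, Complex.norm_real, Complex.norm_real,
      Complex.norm_natCast, Real.norm_eq_abs, Real.norm_eq_abs]
    calc |(legendre n).eval s| * ((‖w‖ * |s|) ^ m / m.factorial)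
        ≤ 1 * ((‖w‖ * 1) ^ m / m.factorial) := by gcongr
      _ = _ := by rw [one_mul, mul_one]
  · exact Filter.Eventually.of_forall fun s _ => Real.summable_pow_div_factorial _
  · exact intervalIntegrable_const
  · refine Filter.Eventually.of_forall fun s _ => HasSum.mul_left _ ?_
    rw [Complex.exp_eq_exp_ℂ]
    exact NormedSpace.expSeries_div_hasSum_exp (w * s)

/-- Expanding the exponential leaves only the moments of order `n + 2k`, and these are the
coefficients of the series defining `j_n`. -/
lemma integral_legendre_mul_exp (n : ℕ) (z : ℂ) :
    ∫ s in (-1 : ℝ)..1, (((legendre n).eval s : ℝ) : ℂ) * Complex.exp (Complex.I * z * s) =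
      2 * Complex.I ^ n * sphericalBessel n z := by
  have h := hasSum_integral_legendre_mul_exp n (Complex.I * z)
  have hinj : Function.Injective fun k : ℕ => n + 2 * k := fun a b hab => by
    simp only at hab; omega
  rw [← hinj.hasSum_iff fun m hm => by
    rw [integral_legendre_mul_pow_of_notMem hm]; simp] at h
  rw [← h.tsum_eq, sphericalBessel, ← tsum_mul_left]
  refine tsum_congr fun k => ?_
  have e := congrArg (fun r : ℝ => (r : ℂ)) (integral_legendre_mul_pow_add n k)
  push_cast at e
  simp only [Function.comp]
  rw [div_mul_eq_mul_div, mul_div_assoc, e, mul_pow, pow_add, pow_mul, Complex.I_sq]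
  ring

lemma sphericalBessel_neg (n : ℕ) (z : ℂ) :
    sphericalBessel n (-z) = (-1) ^ n * sphericalBessel n z := by
  rw [sphericalBessel, sphericalBessel, ← tsum_mul_left]
  refine tsum_congr fun k => ?_
  rw [neg_pow z, pow_add, pow_mul]
  norm_num
  ring

lemma intervalIntegrable_legendre_mul_exp (n : ℕ) (w : ℂ) :
    IntervalIntegrable (fun s : ℝ => (((legendre n).eval s : ℝ) : ℂ) * Complex.exp (w * s))
      MeasureTheory.volume (-1) 1 := by
  have hc := continuous_eval_real (legendre n)
  exact (by fun_prop : Continuous fun s : ℝ =>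
      (((legendre n).eval s : ℝ) : ℂ) * Complex.exp (w * s)).intervalIntegrable _ _

lemma integral_legendre_mul_cos (n : ℕ) (z : ℂ) :
    ∫ s in (-1 : ℝ)..1, (((legendre n).eval s : ℝ) : ℂ) * Complex.cos (z * s) =
      (1 + (-1) ^ n) * Complex.I ^ n * sphericalBessel n z := by
  have h1 := integral_legendre_mul_exp n z
  have h2 := integral_legendre_mul_exp n (-z)
  have : ∀ s : ℝ, (((legendre n).eval s : ℝ) : ℂ) * Complex.cos (z * s) =
      ((((legendre n).eval s : ℝ) : ℂ) * Complex.exp (Complex.I * z * s) +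
      (((legendre n).eval s : ℝ) : ℂ) * Complex.exp (Complex.I * (-z) * s)) * (1 / 2) := by
    intro s
    rw [Complex.cos]
    ring_nf
  simp only [this]
  rw [intervalIntegral.integral_mul_const, intervalIntegral.integral_add
    (intervalIntegrable_legendre_mul_exp _ _) (intervalIntegrable_legendre_mul_exp _ _), h1, h2,
    sphericalBessel_neg]
  ring

lemma integral_legendre_mul_sin (n : ℕ) (z : ℂ) :
    ∫ s in (-1 : ℝ)..1, (((legendre n).eval s : ℝ) : ℂ) * Complex.sin (z * s) =
      -((1 - (-1) ^ n) * Complex.I ^ (n + 1) * sphericalBessel n z) := by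
  have h1 := integral_legendre_mul_exp n z
  have h2 := integral_legendre_mul_exp n (-z)
  have : ∀ s : ℝ, (((legendre n).eval s : ℝ) : ℂ) * Complex.sin (z * s) =
      ((((legendre n).eval s : ℝ) : ℂ) * Complex.exp (Complex.I * (-z) * s) -
      (((legendre n).eval s : ℝ) : ℂ) * Complex.exp (Complex.I * z * s)) * (Complex.I / 2) := by
    intro s
    rw [Complex.sin]
    ring_nf
  simp only [this]
  rw [intervalIntegral.integral_mul_const, intervalIntegral.integral_sub
    (intervalIntegrable_legendre_mul_exp _ _) (intervalIntegrable_legendre_mul_exp _ _), h1, h2,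
    sphericalBessel_neg]
  ring

lemma U0_eq (l : ℂ) (x : ℝ) : U0 l x = Complex.cos (l * x) • (1 : M2) - Complex.sin (l * x) • B := by
  ext i j
  fin_cases i <;> fin_cases j <;> simp [U0, B]

lemma B_mul_B : B * B = -1 := by
  ext i j
  fin_cases i <;> fin_cases j <;> simp [B, Matrix.mul_apply]

lemma continuous_U0 (l : ℂ) : Continuous (U0 l) := by
  have : U0 l = fun x : ℝ => Complex.cos (l * x) • (1 : M2) - Complex.sin (l * x) • B :=
    funext (U0_eq l)
  rw [this]
  fun_prop

/-- Since `U0 = cos - sin · B`, even `n` sees only the cosine and odd `n` only the sine. This is the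
origin of the two cases, and of the right factor `B`, in `coeffTilde`. -/
lemma integral_legendre_smul_U0_unit (n : ℕ) (A : M2) (z : ℂ) :
    ∫ s in (-1 : ℝ)..1, (legendre n).eval s • (A * U0 z s) =
      sphericalBessel n z • (if Even n then (2 * (-1 : ℂ) ^ (n / 2)) • A
        else (2 * (-1 : ℂ) ^ ((n + 1) / 2)) • (A * B)) := by
  have h : ∀ s : ℝ, (legendre n).eval s • (A * U0 z s) =
      ((((legendre n).eval s : ℝ) : ℂ) * Complex.cos (z * s)) • A -
      ((((legendre n).eval s : ℝ) : ℂ) * Complex.sin (z * s)) • (A * B) := by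
    intro s
    rw [U0_eq, mul_sub, mul_smul_comm, mul_smul_comm, mul_one, mul_smul, mul_smul, smul_sub,
      Complex.coe_smul, Complex.coe_smul]
  have hc := continuous_eval_real (legendre n)
  simp only [h]
  rw [intervalIntegral.integral_sub, intervalIntegral.integral_smul_const,
    intervalIntegral.integral_smul_const, integral_legendre_mul_cos, integral_legendre_mul_sin]
  · rcases Nat.even_or_odd' n with ⟨k, rfl | rfl⟩
    · have e : ((-1 : ℂ)) ^ (2 * k) = 1 := by rw [pow_mul]; simp
      rw [if_pos (even_two_mul k), e, pow_mul, Complex.I_sq, Nat.mul_div_cancel_left _ two_pos]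
      simp only [sub_self, zero_mul, neg_zero, zero_smul, sub_zero, smul_smul]
      congr 1
      ring
    · have e : ((-1 : ℂ)) ^ (2 * k + 1) = -1 := by rw [pow_succ, pow_mul]; simp
      rw [if_neg (by simp [parity_simps]), e, show 2 * k + 1 + 1 = 2 * (k + 1) by ring, pow_mul,
        Complex.I_sq, Nat.mul_div_cancel_left _ two_pos]
      simp only [add_neg_cancel, zero_mul, zero_smul, zero_sub, smul_smul, ← neg_smul, neg_neg]
      congr 1
      ring
  · exact (by fun_prop : Continuous fun s : ℝ =>
      ((((legendre n).eval s : ℝ) : ℂ) * Complex.cos (z * s)) • A).intervalIntegrable _ _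
  · exact (by fun_prop : Continuous fun s : ℝ =>
      ((((legendre n).eval s : ℝ) : ℂ) * Complex.sin (z * s)) • (A * B)).intervalIntegrable _ _

lemma integral_legendre_smul_U0 (n : ℕ) (A : M2) (l : ℂ) {x : ℝ} (hx : 0 < x) :
    ∫ t in (-x)..x, (legendre n).eval (t / x) • (A * U0 l t) =
      x • sphericalBessel n (l * x) • (if Even n then (2 * (-1 : ℂ) ^ (n / 2)) • A
        else (2 * (-1 : ℂ) ^ ((n + 1) / 2)) • (A * B)) := by
  rw [← integral_legendre_smul_U0_unit]
  have h := intervalIntegral.integral_comp_mul_left (a := -1) (b := 1)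
    (fun t : ℝ => (legendre n).eval (t / x) • (A * U0 l t)) hx.ne'
  rw [mul_neg, mul_one] at h
  rw [← inv_smul_eq_iff₀ hx.ne', ← h]
  refine intervalIntegral.integral_congr fun s _ => ?_
  simp only [mul_div_cancel_left₀ _ hx.ne', U0]
  push_cast
  simp only [mul_assoc]

end Bessel

end DiracNSBF

namespace DiracNSBF

/-! ### Uniform convergence rate of Legendre series -/

section Approximation

open Polynomial

/-- The moment `∫_{-1}^1 f P_n`. -/
noncomputable def lcoeff (f : ℝ → ℝ) (n : ℕ) : ℝ := ∫ s in (-1 : ℝ)..1, f s * (legendre n).eval s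

/-- The `N`-th partial sum of the Legendre series of `f`. -/
noncomputable def lsum (f : ℝ → ℝ) (N : ℕ) (s : ℝ) : ℝ :=
  ∑ n ∈ Finset.range (N + 1), (2 * n + 1) / 2 * lcoeff f n * (legendre n).eval s

/-- The squared `L²` norm of the `n`-th term of the Legendre series of `f`. -/
noncomputable def lenergy (f : ℝ → ℝ) (n : ℕ) : ℝ := (2 * n + 1) / 2 * lcoeff f n ^ 2

lemma lenergy_nonneg (f : ℝ → ℝ) (n : ℕ) : 0 ≤ lenergy f n := by
  unfold lenergy; positivity

lemma intervalIntegrable_mul_legendre {f : ℝ → ℝ} (hf : Continuous f) (n : ℕ) :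
    IntervalIntegrable (fun s => f s * (legendre n).eval s) MeasureTheory.volume (-1) 1 :=
  (hf.mul (continuous_eval_real _)).intervalIntegrable _ _

lemma lcoeff_add {f g : ℝ → ℝ} (hf : Continuous f) (hg : Continuous g) (n : ℕ) :
    lcoeff (fun s => f s + g s) n = lcoeff f n + lcoeff g n := by
  simp only [lcoeff, add_mul]
  exact intervalIntegral.integral_add (intervalIntegrable_mul_legendre hf n)
    (intervalIntegrable_mul_legendre hg n)

lemma lcoeff_const_mul (a : ℝ) (f : ℝ → ℝ) (n : ℕ) :
    lcoeff (fun s => a * f s) n = a * lcoeff f n := by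
  simp only [lcoeff, mul_assoc, intervalIntegral.integral_const_mul]

lemma lsum_add {f g : ℝ → ℝ} (hf : Continuous f) (hg : Continuous g) (N : ℕ) (s : ℝ) :
    lsum (fun s => f s + g s) N s = lsum f N s + lsum g N s := by
  simp only [lsum, lcoeff_add hf hg, ← Finset.sum_add_distrib]
  exact Finset.sum_congr rfl fun n _ => by ring

lemma lsum_const_mul (a : ℝ) (f : ℝ → ℝ) (N : ℕ) (s : ℝ) :
    lsum (fun s => a * f s) N s = a * lsum f N s := by
  simp only [lsum, lcoeff_const_mul, Finset.mul_sum]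
  exact Finset.sum_congr rfl fun n _ => by ring

lemma lcoeff_legendre (m n : ℕ) :
    lcoeff (fun s => (legendre m).eval s) n = if n = m then 2 / (2 * m + 1 : ℝ) else 0 := by
  split_ifs with h
  · subst h; exact integral_legendre_sq n
  · exact integral_legendre_mul_legendre_of_ne (Ne.symm h)

lemma lsum_legendre {m N : ℕ} (h : m ≤ N) (s : ℝ) :
    lsum (fun s => (legendre m).eval s) N s = (legendre m).eval s := by
  simp only [lsum, lcoeff_legendre]
  rw [Finset.sum_eq_single m]
  · rw [if_pos rfl]; field_simp
  · intro n _ hn; rw [if_neg hn]; simp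
  · intro hm; exact absurd (Finset.mem_range.2 (by omega)) hm

/-- Seed of the density argument in `lsum_tendsto`: a polynomial is a finite combination of the
`P_n`. -/
lemma exists_lsum_polynomial_eq (q : ℝ[X]) :
    ∃ M₀, ∀ M ≥ M₀, ∀ s, lsum (fun s => q.eval s) M s = q.eval s := by
  have hq := mem_span_legendre q
  induction hq using Submodule.span_induction with
  | mem q hq =>
    obtain ⟨m, rfl⟩ := hq
    exact ⟨m, fun M hM s => lsum_legendre hM s⟩
  | zero => exact ⟨0, fun M _ s => by simp [lsum, lcoeff]⟩
  | add a b _ _ ha hb =>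
    obtain ⟨Ma, ha⟩ := ha
    obtain ⟨Mb, hb⟩ := hb
    refine ⟨max Ma Mb, fun M hM s => ?_⟩
    simp only [eval_add]
    rw [lsum_add (continuous_eval_real a) (continuous_eval_real b),
      ha M (le_of_max_le_left hM), hb M (le_of_max_le_right hM)]
  | smul c a _ ha =>
    obtain ⟨Ma, ha⟩ := ha
    refine ⟨Ma, fun M hM s => ?_⟩
    simp only [eval_smul, smul_eq_mul]
    rw [lsum_const_mul, ha M hM]

/-- Bessel's inequality. -/
lemma sum_lenergy_le {f : ℝ → ℝ} (hf : Continuous f) (S : Finset ℕ) :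
    ∑ n ∈ S, lenergy f n ≤ ∫ s in (-1 : ℝ)..1, f s ^ 2 := by
  let g : ℝ → ℝ := fun s => ∑ n ∈ S, (2 * n + 1) / 2 * lcoeff f n * (legendre n).eval s
  have hg : Continuous g := continuous_finsetSum _ fun n _ =>
    continuous_const.mul (continuous_eval_real _)
  have key : ∀ h : ℝ → ℝ, Continuous h → ∫ s in (-1 : ℝ)..1, h s * g s =
      ∑ n ∈ S, (2 * n + 1) / 2 * lcoeff f n * lcoeff h n := by
    intro h hh
    simp only [g, Finset.mul_sum]
    rw [intervalIntegral.integral_finsetSum]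
    · refine Finset.sum_congr rfl fun n _ => ?_
      rw [lcoeff.eq_def h, ← intervalIntegral.integral_const_mul]
      exact intervalIntegral.integral_congr fun s _ => by ring
    · intro n _
      exact (hh.mul (continuous_const.mul (continuous_eval_real _))).intervalIntegrable _ _
  have hgc : ∀ n ∈ S, lcoeff g n = lcoeff f n := by
    intro n hn
    have h := key (fun s => (legendre n).eval s) (continuous_eval_real _)
    simp only [lcoeff_legendre] at h
    rw [lcoeff]
    simp only [mul_comm (g _)]
    rw [h, Finset.sum_eq_single n]
    · rw [if_pos rfl]; field_simp
    · intro m _ hm; rw [if_neg hm]; simp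
    · intro h; exact absurd hn h
  have e1 : ∫ s in (-1 : ℝ)..1, f s * g s = ∑ n ∈ S, lenergy f n := by
    rw [key f hf]; exact Finset.sum_congr rfl fun n _ => by rw [lenergy]; ring
  have e2 : ∫ s in (-1 : ℝ)..1, g s * g s = ∑ n ∈ S, lenergy f n := by
    rw [key g hg]
    exact Finset.sum_congr rfl fun n hn => by rw [hgc n hn, lenergy]; ring
  have e3 : 0 ≤ ∫ s in (-1 : ℝ)..1, (f s - g s) ^ 2 :=
    intervalIntegral.integral_nonneg (by norm_num) fun s _ => sq_nonneg _
  have e4 : ∀ s, (f s - g s) ^ 2 = f s ^ 2 - 2 * (f s * g s) + g s * g s := fun s => by ring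
  simp only [e4] at e3
  rw [intervalIntegral.integral_add, intervalIntegral.integral_sub,
    intervalIntegral.integral_const_mul, e1, e2] at e3
  · linarith
  all_goals exact Continuous.intervalIntegrable (by fun_prop) _ _

lemma sum_lenergy_le_of_abs_le {f : ℝ → ℝ} (hf : Continuous f) {A : ℝ}
    (hA : ∀ s ∈ Set.Icc (-1 : ℝ) 1, |f s| ≤ A) (S : Finset ℕ) :
    ∑ n ∈ S, lenergy f n ≤ 2 * A ^ 2 := by
  refine (sum_lenergy_le hf S).trans ?_
  have h : ∫ s in (-1 : ℝ)..1, f s ^ 2 ≤ ∫ _ in (-1 : ℝ)..1, A ^ 2 := by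
    refine intervalIntegral.integral_mono_on (by norm_num)
      ((hf.pow 2).intervalIntegrable _ _) intervalIntegrable_const fun s hs => ?_
    rw [← sq_abs]
    exact pow_le_pow_left₀ (abs_nonneg _) (hA s hs) 2
  refine h.trans (le_of_eq ?_)
  rw [intervalIntegral.integral_const]
  norm_num

/-- Integrate by parts against `P_{n+2} - P_n`, which vanishes at `±1` and is a primitive of `(2n+3)
P_{n+1}`. -/
lemma lcoeff_deriv {f f' : ℝ → ℝ} (hf : ∀ s, HasDerivAt f (f' s) s) (hc : Continuous f') (n : ℕ) :
    (2 * n + 3) * lcoeff f (n + 1) = lcoeff f' n - lcoeff f' (n + 2) := by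
  have h := intervalIntegral.integral_mul_deriv_eq_deriv_mul (a := -1) (b := 1)
    (fun s _ => hf s)
    (fun s _ => ((legendre (n + 2)).hasDerivAt s).sub ((legendre n).hasDerivAt s))
    (hc.intervalIntegrable _ _)
    (Continuous.intervalIntegrable
      ((derivative (legendre (n + 2))).continuous.sub (derivative (legendre n)).continuous) _ _)
  have e : ∀ s, f s * (eval s (derivative (legendre (n + 2))) - eval s (derivative (legendre n))) =
      (2 * n + 3) * (f s * (legendre (n + 1)).eval s) := by
    intro s
    have h := congrArg (eval s) (derivative_legendre_add_two n)
    simp only [eval_add, eval_mul, eval_C] at h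
    rw [h]; ring
  simp only [e, Pi.sub_apply, mul_sub] at h
  rw [intervalIntegral.integral_const_mul, intervalIntegral.integral_sub
    (intervalIntegrable_mul_legendre hc _) (intervalIntegrable_mul_legendre hc _)] at h
  simp only [legendre_eval_one, legendre_eval_neg_one, pow_add] at h
  simp only [lcoeff]
  rw [h]; ring

/-- Decay of the tail energies of the Legendre series is gained by differentiability. -/
lemma tail_lenergy_le_of_deriv {f f' : ℝ → ℝ} (hf : ∀ s, HasDerivAt f (f' s) s)
    (hc : Continuous f') {N : ℕ} {E : ℝ}
    (hE : ∀ M, ∑ n ∈ Finset.Ico N M, lenergy f' n ≤ E) (M : ℕ) :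
    ∑ n ∈ Finset.Ico (N + 1) M, lenergy f n ≤ 2 * E / (N + 1) ^ 2 := by
  have step : ∀ m ∈ Finset.Ico N M, lenergy f (m + 1) ≤
      (lenergy f' m + lenergy f' (m + 2)) / (N + 1) ^ 2 := by
    intro m hm
    have hNm : (N : ℝ) ≤ m := by exact_mod_cast (Finset.mem_Ico.1 hm).1
    have h := lcoeff_deriv hf hc m
    have hN0 : (0 : ℝ) ≤ N := N.cast_nonneg
    have hm0 : (0 : ℝ) ≤ m := m.cast_nonneg
    rw [le_div_iff₀ (by positivity)]
    have h1 : (N + 1 : ℝ) ^ 2 ≤ (m + 1) ^ 2 := by gcongr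
    refine (mul_le_mul_of_nonneg_left h1 (lenergy_nonneg _ _)).trans ?_
    simp only [lenergy]
    push_cast
    set a := lcoeff f' m
    set c := lcoeff f' (m + 2)
    -- By `lcoeff_deriv` the energy of `f` at `m+1` is `(a-c)² / (2(2m+3))`, to be compared with `a²
    -- + c²`.
    have h2 : (2 * m + 3) * ((2 * ((m : ℝ) + 1) + 1) / 2 * lcoeff f (m + 1) ^ 2 * (m + 1) ^ 2) =
        (a - c) ^ 2 / 2 * (m + 1) ^ 2 := by rw [← h]; ring
    have h3 : (a - c) ^ 2 / 2 * (m + 1) ^ 2 ≤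
        (2 * m + 3) * ((2 * (m : ℝ) + 1) / 2 * a ^ 2 + (2 * ((m : ℝ) + 2) + 1) / 2 * c ^ 2) := by
      have : (a - c) ^ 2 / 2 ≤ a ^ 2 + c ^ 2 := by nlinarith [sq_nonneg (a + c)]
      have h5 : (a - c) ^ 2 / 2 * (m + 1 : ℝ) ^ 2 ≤ (a ^ 2 + c ^ 2) * (m + 1) ^ 2 := by gcongr
      nlinarith [mul_nonneg hm0 (sq_nonneg a), mul_nonneg hm0 (sq_nonneg c),
        mul_nonneg (mul_nonneg hm0 hm0) (sq_nonneg a), mul_nonneg (mul_nonneg hm0 hm0) (sq_nonneg c),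
        sq_nonneg a, sq_nonneg c]
    rw [← h2] at h3
    exact le_of_mul_le_mul_left h3 (by positivity)
  have s0 : ∑ n ∈ Finset.Ico (N + 1) M, lenergy f n ≤ ∑ m ∈ Finset.Ico N M, lenergy f (m + 1) := by
    rw [Finset.sum_Ico_add' (fun n => lenergy f n) N M 1]
    exact Finset.sum_le_sum_of_subset_of_nonneg (Finset.Ico_subset_Ico_right (by omega))
      fun _ _ _ => lenergy_nonneg _ _
  -- The factor 2 arises because each energy of `f'` is counted at most twice, from `m` and from `m
  -- + 2`.
  refine s0.trans ((Finset.sum_le_sum step).trans ?_)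
  rw [← Finset.sum_div, Finset.sum_add_distrib]
  gcongr
  have s1 := hE M
  have s2 : ∑ m ∈ Finset.Ico N M, lenergy f' (m + 2) ≤ E := by
    rw [Finset.sum_Ico_add' (fun n => lenergy f' n) N M 2]
    exact (Finset.sum_le_sum_of_subset_of_nonneg (Finset.Ico_subset_Ico_left (by omega))
      fun _ _ _ => lenergy_nonneg _ _).trans (hE (M + 2))
  linarith

/-- Induction on the number of derivatives, with Bessel's inequality as base. Each derivative shifts
the start of the tail by one, hence `k + p`; bounding every gain by the weakest, `(k+1)^(-2)`, gives
a pure power. -/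
lemma tail_lenergy_le (p : ℕ) : ∀ {f : ℝ → ℝ}, ContDiff ℝ p f → ∀ {A : ℝ},
    (∀ s ∈ Set.Icc (-1 : ℝ) 1, |iteratedDeriv p f s| ≤ A) → ∀ k M : ℕ,
    ∑ n ∈ Finset.Ico (k + p) M, lenergy f n ≤ 2 * A ^ 2 * 2 ^ p / ((k + 1 : ℝ) ^ p) ^ 2 := by
  induction p with
  | zero =>
    intro f hf A hA k M
    simp only [iteratedDeriv_zero] at hA
    simpa using sum_lenergy_le_of_abs_le hf.continuous hA (Finset.Ico (k + 0) M)
  | succ p ih =>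
    intro f hf A hA k M
    have hf' : ContDiff ℝ p (deriv f) := by
      have : ContDiff ℝ ((p : WithTop ℕ∞) + 1) f := by exact_mod_cast hf
      exact (contDiff_succ_iff_deriv.1 this).2.2
    have hd : ∀ s, HasDerivAt f (deriv f s) s := fun s =>
      ((hf.differentiable (by norm_cast)) s).hasDerivAt
    rw [iteratedDeriv_succ'] at hA
    refine (tail_lenergy_le_of_deriv hd hf'.continuous (ih hf' hA k) M).trans ?_
    have : (k + 1 : ℝ) ^ 2 ≤ (((k + p : ℕ) : ℝ) + 1) ^ 2 := by
      push_cast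
      gcongr
      linarith [Nat.cast_nonneg (α := ℝ) p]
    calc 2 * (2 * A ^ 2 * 2 ^ p / ((k + 1 : ℝ) ^ p) ^ 2) / (((k + p : ℕ) : ℝ) + 1) ^ 2
        ≤ 2 * (2 * A ^ 2 * 2 ^ p / ((k + 1 : ℝ) ^ p) ^ 2) / (k + 1 : ℝ) ^ 2 := by gcongr
      _ = _ := by rw [pow_succ (2 : ℝ), pow_succ (k + 1 : ℝ) p]; field_simp

/-- Summation by parts with `lcoeff_deriv`. With only `|P_n| ≤ 1`, Cauchy–Schwarz would leave a
harmonic sum; the differences supply the missing decay, at the price of four boundary terms. -/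
lemma two_mul_lsum_sub {f f' : ℝ → ℝ} (hf : ∀ s, HasDerivAt f (f' s) s) (hc : Continuous f')
    (N k : ℕ) (s : ℝ) :
    2 * (lsum f (N + k) s - lsum f N s) =
      ∑ i ∈ Finset.range k, lcoeff f' (N + i + 1) *
        ((legendre (N + i + 2)).eval s - (legendre (N + i)).eval s) +
      lcoeff f' N * (legendre (N + 1)).eval s + lcoeff f' (N + 1) * (legendre N).eval s -
      lcoeff f' (N + k) * (legendre (N + k + 1)).eval s -
      lcoeff f' (N + k + 1) * (legendre (N + k)).eval s := by
  induction k with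
  | zero => simp
  | succ k ih =>
    have h1 : lsum f (N + (k + 1)) s = lsum f (N + k) s +
        (2 * ((N + k : ℕ) + 1 : ℝ) + 1) / 2 * lcoeff f (N + k + 1) *
          (legendre (N + k + 1)).eval s := by
      rw [lsum, lsum, ← add_assoc, Finset.sum_range_succ]
      push_cast
      rfl
    have h2 := lcoeff_deriv hf hc (N + k)
    rw [h1, Finset.sum_range_succ]
    simp only [← add_assoc] at ih ⊢
    linear_combination ih + (legendre (N + k + 1)).eval s * h2

lemma sum_inv_sq_le {N : ℕ} (hN : 0 < N) (k : ℕ) :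
    ∑ i ∈ Finset.range k, 1 / ((N + i + 1 : ℝ)) ^ 2 ≤ 1 / (N : ℝ) - 1 / (N + k) := by
  have hN' : (0 : ℝ) < N := by exact_mod_cast hN
  induction k with
  | zero => simp
  | succ k ih =>
    rw [Finset.sum_range_succ]
    have h : 1 / ((N : ℝ) + k + 1) ^ 2 ≤ 1 / (N + k) - 1 / (N + k + 1) := by
      rw [div_sub_div _ _ (by positivity) (by positivity), div_le_div_iff₀ (by positivity)
        (by positivity)]
      nlinarith [Nat.cast_nonneg (α := ℝ) k]
    push_cast
    rw [← add_assoc]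
    linarith

/-- Cauchy–Schwarz with weights `(2n+1)/2`: the moments contribute `E`, the differences at most `∑
8/n² ≤ 8/N`, so the sum is at most `3√(E/N)`. Each boundary term is at most `√(E/N)`, and `3 + 4 ≤ 2
· 4`. -/
lemma abs_lsum_sub_le {f f' : ℝ → ℝ} (hf : ∀ s, HasDerivAt f (f' s) s) (hc : Continuous f')
    {N : ℕ} (hN : 0 < N) {E : ℝ} (hE : ∀ M, ∑ n ∈ Finset.Ico N M, lenergy f' n ≤ E)
    {M : ℕ} (hM : N ≤ M) {s : ℝ} (hs : s ∈ Set.Icc (-1 : ℝ) 1) :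
    |lsum f M s - lsum f N s| ≤ 4 * √(E / N) := by
  have hN' : (0 : ℝ) < N := by exact_mod_cast hN
  obtain ⟨k, rfl⟩ := Nat.exists_eq_add_of_le hM
  have hE0 : 0 ≤ E := (Finset.sum_nonneg fun _ _ => lenergy_nonneg _ _).trans (hE 0)
  have hb : ∀ j ≥ N, ∀ m, |lcoeff f' j * (legendre m).eval s| ≤ √(E / N) := by
    intro j hj m
    have h1 : lenergy f' j ≤ E := (Finset.single_le_sum (f := lenergy f')
      (fun _ _ => lenergy_nonneg _ _) (Finset.mem_Ico.2 ⟨hj, Nat.lt_succ_self j⟩)).trans (hE _)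
    have hj' : (N : ℝ) ≤ j := by exact_mod_cast hj
    have h2 : lcoeff f' j ^ 2 ≤ E / N := by
      rw [le_div_iff₀ hN']
      refine le_trans ?_ h1
      rw [lenergy]
      nlinarith [sq_nonneg (lcoeff f' j)]
    rw [abs_mul]
    calc |lcoeff f' j| * |(legendre m).eval s| ≤ √(E / N) * 1 := by
          gcongr
          · exact Real.abs_le_sqrt h2
          · exact abs_legendre_le_one m hs
      _ = _ := mul_one _
  have hm : |∑ i ∈ Finset.range k, lcoeff f' (N + i + 1) *
        ((legendre (N + i + 2)).eval s - (legendre (N + i)).eval s)| ≤ 3 * √(E / N) := by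
    have h9 : (3 : ℝ) * √(E / N) = √(9 * (E / N)) := by
      rw [Real.sqrt_mul (by norm_num), show (9 : ℝ) = 3 ^ 2 by norm_num, Real.sqrt_sq (by norm_num)]
    rw [h9]
    refine Real.abs_le_sqrt ?_
    have hcs := Finset.sum_sq_le_sum_mul_sum_of_sq_le_mul (Finset.range k)
      (r := fun i => lcoeff f' (N + i + 1) *
        ((legendre (N + i + 2)).eval s - (legendre (N + i)).eval s))
      (f := fun i => lenergy f' (N + i + 1))
      (g := fun i => 2 / (2 * (N + i + 1 : ℝ) + 1) *
        ((legendre (N + i + 2)).eval s - (legendre (N + i)).eval s) ^ 2)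
      (fun i _ => lenergy_nonneg _ _) (fun i _ => by positivity) (fun i _ => by
        simp only [lenergy]; push_cast; exact le_of_eq (by field_simp))
    refine hcs.trans ?_
    have t1 : ∑ i ∈ Finset.range k, lenergy f' (N + i + 1) ≤ E := by
      refine le_trans ?_ (hE (N + k + 1))
      have : ∑ i ∈ Finset.range k, lenergy f' (N + i + 1) =
          ∑ n ∈ Finset.Ico (N + 1) (N + k + 1), lenergy f' n := by
        rw [Finset.sum_Ico_eq_sum_range, show N + k + 1 - (N + 1) = k by omega]
        exact Finset.sum_congr rfl fun i _ => by rw [add_right_comm]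
      rw [this]
      exact Finset.sum_le_sum_of_subset_of_nonneg (Finset.Ico_subset_Ico_left (by omega))
        fun _ _ _ => lenergy_nonneg _ _
    have t2 : ∑ i ∈ Finset.range k, 2 / (2 * (N + i + 1 : ℝ) + 1) *
        ((legendre (N + i + 2)).eval s - (legendre (N + i)).eval s) ^ 2 ≤ 8 * (1 / (N : ℝ)) := by
      have t3 : ∀ i ∈ Finset.range k, 2 / (2 * (N + i + 1 : ℝ) + 1) *
          ((legendre (N + i + 2)).eval s - (legendre (N + i)).eval s) ^ 2 ≤
          8 * (1 / (N + i + 1 : ℝ) ^ 2) := by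
        intro i _
        have h := legendre_sub_sq_le (N + i) hs
        push_cast at h
        have h' : 2 / (2 * (N + i + 1 : ℝ) + 1) ≤ 1 / (N + i + 1) := by
          rw [div_le_div_iff₀ (by positivity) (by positivity)]; linarith
        calc _ ≤ 1 / (N + i + 1 : ℝ) * (8 / (N + i + 1)) := by gcongr
          _ = _ := by field_simp
      refine (Finset.sum_le_sum t3).trans ?_
      rw [← Finset.mul_sum]
      have := sum_inv_sq_le hN k
      have h0 : (0 : ℝ) ≤ 1 / (N + k) := by positivity
      linarith
    have t4 : 0 ≤ ∑ i ∈ Finset.range k, 2 / (2 * (N + i + 1 : ℝ) + 1) *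
        ((legendre (N + i + 2)).eval s - (legendre (N + i)).eval s) ^ 2 :=
      Finset.sum_nonneg fun i _ => by positivity
    calc _ ≤ E * (8 * (1 / N)) := mul_le_mul t1 t2 t4 hE0
      _ ≤ 9 * (E / N) := by
        have : 0 ≤ E / N := by positivity
        have e : E * (8 * (1 / N)) = 8 * (E / N) := by ring
        rw [e]; linarith
  have h := two_mul_lsum_sub hf hc N k s
  have b1 := abs_le.1 (hb N le_rfl (N + 1))
  have b2 := abs_le.1 (hb (N + 1) (by omega) N)
  have b3 := abs_le.1 (hb (N + k) (by omega) (N + k + 1))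
  have b4 := abs_le.1 (hb (N + k + 1) (by omega) (N + k))
  have b5 := abs_le.1 hm
  rw [abs_le]
  constructor <;> linarith [Real.sqrt_nonneg (E / N)]

lemma exists_derivative_eq (q : ℝ[X]) : ∃ r : ℝ[X], derivative r = q := by
  induction q using Polynomial.induction_on' with
  | add a b ha hb =>
    obtain ⟨r, rfl⟩ := ha
    obtain ⟨t, rfl⟩ := hb
    exact ⟨r + t, derivative_add⟩
  | monomial n a =>
    refine ⟨monomial (n + 1) (a / (n + 1)), ?_⟩
    rw [derivative_monomial, Nat.add_sub_cancel]
    congr 1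
    push_cast
    field_simp

/-- Density: approximate `f'` by a polynomial and integrate, so that `h = f - q` and `h'` are small
while the series of `q` terminates. The partial sums of `h` are controlled through
`abs_lsum_sub_le`. -/
lemma lsum_tendsto {f f' : ℝ → ℝ} (hf : ∀ s, HasDerivAt f (f' s) s) (hc : Continuous f')
    {s : ℝ} (hs : s ∈ Set.Icc (-1 : ℝ) 1) {δ : ℝ} (hδ : 0 < δ) :
    ∃ M₀, ∀ M ≥ M₀, |f s - lsum f M s| ≤ 20 * δ := by
  obtain ⟨q₀, hq₀⟩ := exists_polynomial_near_of_continuousOn (-1) 1 f' hc.continuousOn δ hδ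
  obtain ⟨r, hr⟩ := exists_derivative_eq q₀
  set q : ℝ[X] := r + C (f (-1) - r.eval (-1)) with hq
  have hqd : derivative q = q₀ := by simp [hq, hr]
  let h : ℝ → ℝ := fun t => f t + -1 * q.eval t
  let h' : ℝ → ℝ := fun t => f' t + -1 * q₀.eval t
  have hh : ∀ t, HasDerivAt h (h' t) t := fun t =>
    (hf t).add (((q.hasDerivAt t).const_mul (-1)).congr_deriv (by rw [hqd]))
  have hh'c : Continuous h' := hc.add (continuous_const.mul (continuous_eval_real q₀))
  have hfc : Continuous f := continuous_iff_continuousAt.2 fun t => (hf t).continuousAt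
  have hhc : Continuous h := continuous_iff_continuousAt.2 fun t => (hh t).continuousAt
  have hb' : ∀ t ∈ Set.Icc (-1 : ℝ) 1, |h' t| ≤ δ := by
    intro t ht
    have := (hq₀ t ht).le
    rw [abs_sub_comm] at this
    simpa [h', sub_eq_add_neg] using this
  have hb : ∀ t ∈ Set.Icc (-1 : ℝ) 1, |h t| ≤ 2 * δ := by
    intro t ht
    have h0 : h (-1) = 0 := by
      simp only [h, q, eval_add, eval_C]; ring
    have := (convex_Icc (-1 : ℝ) 1).norm_image_sub_le_of_norm_hasDerivWithin_le
      (fun t _ => (hh t).hasDerivWithinAt) hb' (Set.left_mem_Icc.2 (by norm_num)) ht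
    rw [h0, sub_zero, Real.norm_eq_abs, Real.norm_eq_abs,
      abs_of_nonneg (show 0 ≤ t - -1 by linarith [ht.1])] at this
    nlinarith [ht.1, ht.2]
  obtain ⟨M₀, hM₀⟩ := exists_lsum_polynomial_eq q
  refine ⟨max M₀ 1, fun M hM => ?_⟩
  have hsplit : lsum h M s = lsum f M s + -1 * q.eval s := by
    rw [lsum_add (g := fun t => -1 * q.eval t) hfc
      (continuous_const.mul (continuous_eval_real q)), lsum_const_mul,
      hM₀ M (le_of_max_le_left hM)]
  -- The comparison starts at index 1 because the estimate needs a positive index; the sum up to 1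
  -- is bounded by hand. In total `8δ + 8δ + 2δ ≤ 20δ`.
  have hsup := abs_lsum_sub_le hh hh'c one_pos (E := 2 * δ ^ 2)
    (fun M => sum_lenergy_le_of_abs_le hh'c hb' _) (le_of_max_le_right hM) hs
  have hcoef : ∀ n, |lcoeff h n| ≤ 4 * δ := by
    intro n
    have := intervalIntegral.norm_integral_le_of_norm_le_const (a := -1) (b := 1) (C := 2 * δ)
      (f := fun s => h s * (legendre n).eval s) (fun t ht => by
        rw [Set.uIoc_of_le (by norm_num)] at ht
        have ht := Set.Ioc_subset_Icc_self ht
        rw [norm_mul]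
        calc ‖h t‖ * ‖(legendre n).eval t‖ ≤ 2 * δ * 1 := by
              gcongr
              · exact hb t ht
              · exact abs_legendre_le_one n ht
          _ = _ := mul_one _)
    norm_num at this
    rw [lcoeff]
    linarith
  have h1 : |lsum h 1 s| ≤ 8 * δ := by
    have e : lsum h 1 s = 1 / 2 * lcoeff h 0 + 3 / 2 * lcoeff h 1 * s := by
      simp [lsum, Finset.sum_range_succ, legendre_zero, legendre_one]
      norm_num
    have c0 := hcoef 0
    have c1 := hcoef 1
    have hs' : |s| ≤ 1 := abs_le.2 hs
    rw [e]
    calc _ ≤ |1 / 2 * lcoeff h 0| + |3 / 2 * lcoeff h 1 * s| := abs_add_le _ _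
      _ = 1 / 2 * |lcoeff h 0| + 3 / 2 * |lcoeff h 1| * |s| := by
        simp only [abs_mul]; norm_num
      _ ≤ 1 / 2 * (4 * δ) + 3 / 2 * (4 * δ) * 1 := by gcongr
      _ = _ := by ring
  have h2 : √(2 * δ ^ 2 / (1 : ℕ)) ≤ 2 * δ := by
    refine Real.sqrt_le_iff.2 ⟨by positivity, ?_⟩
    norm_num
    nlinarith
  have h3 : f s - lsum f M s = h s - lsum h M s := by rw [hsplit]; simp only [h]; ring
  have h4 := hb s hs
  rw [h3]
  rw [abs_le] at *
  constructor <;> linarith [h1.1, h1.2, h4.1, h4.2, hsup.1, hsup.2]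

lemma abs_sub_lsum_le {f f' : ℝ → ℝ} (hf : ∀ s, HasDerivAt f (f' s) s) (hc : Continuous f')
    {N : ℕ} (hN : 0 < N) {E : ℝ} (hE : ∀ M, ∑ n ∈ Finset.Ico N M, lenergy f' n ≤ E)
    {s : ℝ} (hs : s ∈ Set.Icc (-1 : ℝ) 1) :
    |f s - lsum f N s| ≤ 4 * √(E / N) := by
  refine le_of_forall_pos_le_add fun ε hε => ?_
  obtain ⟨M₀, hM₀⟩ := lsum_tendsto hf hc hs (show 0 < ε / 20 by positivity)
  have h1 := hM₀ (max M₀ N) (le_max_left _ _)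
  have h2 := abs_lsum_sub_le hf hc hN hE (le_max_right M₀ N) hs
  rw [abs_le] at *
  constructor <;> linarith [h1.1, h1.2, h2.1, h2.2]

/-- Uniform convergence rate of Legendre series. -/
theorem abs_sub_lsum_le_of_contDiff (p : ℕ) {f : ℝ → ℝ} (hf : ContDiff ℝ (p + 1) f) {A : ℝ}
    (hA : ∀ s ∈ Set.Icc (-1 : ℝ) 1, |iteratedDeriv (p + 1) f s| ≤ A) {N : ℕ} (hN : p + 1 < N)
    {s : ℝ} (hs : s ∈ Set.Icc (-1 : ℝ) 1) :
    |f s - lsum f N s| ≤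
      (4 * 2 ^ (p + 1) * (p + 1) ^ p) * A / (N : ℝ) ^ ((p : ℝ) + 1 / 2) := by
  have hA0 : 0 ≤ A := (abs_nonneg _).trans (hA 0 ⟨by norm_num, by norm_num⟩)
  have hN0 : (0 : ℝ) < N := by exact_mod_cast (by omega : 0 < N)
  have hd : ∀ s, HasDerivAt f (deriv f s) s := fun s =>
    ((hf.differentiable (by norm_cast)) s).hasDerivAt
  have hf' : ContDiff ℝ p (deriv f) := (contDiff_succ_iff_deriv.1 hf).2.2
  -- The tail estimate for the `p` derivatives of `f'` starts at `k + p`; the remaining derivative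
  -- is spent on the sup norm.
  obtain ⟨k, rfl⟩ : ∃ k, N = k + p := ⟨N - p, by omega⟩
  rw [iteratedDeriv_succ'] at hA
  refine (abs_sub_lsum_le hd hf'.continuous (by omega) (tail_lenergy_le p hf' hA k) hs).trans ?_
  -- Replacing `k + 1` by `N` costs the factor `(p+1)^p` of the constant; `2^(p+1)` is a crude bound
  -- for its own square root.
  have hk : ((k + p : ℕ) : ℝ) ≤ (p + 1) * (k + 1) := by
    push_cast
    nlinarith [Nat.cast_nonneg (α := ℝ) k, Nat.cast_nonneg (α := ℝ) p,
      mul_nonneg (Nat.cast_nonneg (α := ℝ) k) (Nat.cast_nonneg (α := ℝ) p)]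
  set n : ℝ := ((k + p : ℕ) : ℝ)
  rw [Real.rpow_add hN0, Real.rpow_natCast, ← Real.sqrt_eq_rpow, Real.sqrt_div' _ hN0.le]
  have h1 : √(2 * A ^ 2 * 2 ^ p / ((k + 1 : ℝ) ^ p) ^ 2) ≤ 2 ^ (p + 1) * (A / (k + 1 : ℝ) ^ p) := by
    refine Real.sqrt_le_iff.2 ⟨by positivity, ?_⟩
    have e : 2 * A ^ 2 * 2 ^ p / ((k + 1 : ℝ) ^ p) ^ 2 = 2 ^ (p + 1) * (A / (k + 1 : ℝ) ^ p) ^ 2 := by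
      rw [div_pow]; ring
    rw [e, mul_pow]
    have : (1 : ℝ) ≤ 2 ^ (p + 1) := one_le_pow₀ (by norm_num)
    gcongr
    nlinarith
  have h2 : A / (k + 1 : ℝ) ^ p ≤ (p + 1) ^ p * A / n ^ p := by
    rw [div_le_div_iff₀ (by positivity) (by positivity)]
    have : n ^ p ≤ ((p + 1) * (k + 1) : ℝ) ^ p := by gcongr
    rw [mul_pow] at this
    nlinarith
  calc 4 * (√(2 * A ^ 2 * 2 ^ p / ((k + 1 : ℝ) ^ p) ^ 2) / √n)
      ≤ 4 * (2 ^ (p + 1) * ((p + 1) ^ p * A / n ^ p) / √n) := by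
        gcongr
        exact h1.trans (by gcongr)
    _ = _ := by field_simp

end Approximation

end DiracNSBF

namespace DiracNSBF

/-! ### Smoothness of primitives in one of two variables -/

section PartialPrimitive

variable {E : Type*} [NormedAddCommGroup E] [NormedSpace ℝ E]

/-- The primitive in the first variable, `(x, y) ↦ ∫_0^x f(s, y) ds`. -/
noncomputable def primitive (f : ℝ × ℝ → E) (z : ℝ × ℝ) : E := ∫ s in (0 : ℝ)..z.1, f (s, z.2)

lemma continuous_primitive {f : ℝ × ℝ → E} (hf : Continuous f) : Continuous (primitive f) :=
  intervalIntegral.continuous_parametric_intervalIntegral_of_continuous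
    (f := fun (z : ℝ × ℝ) s => f (s, z.2)) (by fun_prop) continuous_fst

lemma hasDerivAt_integral_param {f g : ℝ × ℝ → E} (hf : Continuous f)
    (hg : Continuous g) (hfg : ∀ s y, HasDerivAt (fun y => f (s, y)) (g (s, y)) y) (x y : ℝ) :
    HasDerivAt (fun y => ∫ s in (0 : ℝ)..x, f (s, y)) (∫ s in (0 : ℝ)..x, g (s, y)) y := by
  obtain ⟨C, hC⟩ := ((isCompact_uIcc (a := 0) (b := x)).prod
    (isCompact_closedBall y 1)).exists_bound_of_continuousOn hg.continuousOn
  refine (intervalIntegral.hasDerivAt_integral_of_dominated_loc_of_deriv_le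
    (F := fun y s => f (s, y)) (F' := fun y s => g (s, y)) (bound := fun _ => C)
    (Metric.ball_mem_nhds y one_pos) ?_ ?_ ?_ ?_ ?_ ?_).2
  · exact Filter.Eventually.of_forall fun y =>
      (by fun_prop : Continuous fun s => f (s, y)).aestronglyMeasurable
  · exact (by fun_prop : Continuous fun s => f (s, y)).intervalIntegrable _ _
  · exact (by fun_prop : Continuous fun s => g (s, y)).aestronglyMeasurable
  · exact Filter.Eventually.of_forall fun s hs y' hy' =>
      hC _ ⟨Set.uIoc_subset_uIcc hs, Metric.ball_subset_closedBall hy'⟩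
  · exact intervalIntegrable_const
  · exact Filter.Eventually.of_forall fun s _ y' _ => hfg s y'

lemma hasDerivAt_snd_of_differentiable {f : ℝ × ℝ → E} (hf : Differentiable ℝ f) (s y : ℝ) :
    HasDerivAt (fun y => f (s, y)) (fderiv ℝ f (s, y) (0, 1)) y :=
  (hf (s, y)).hasFDerivAt.comp_hasDerivAt y ((hasDerivAt_const y s).prodMk (hasDerivAt_id y))

variable [CompleteSpace E]

lemma hasFDerivAt_primitive {f g : ℝ × ℝ → E} (hf : Continuous f) (hg : Continuous g)
    (hfg : ∀ s y, HasDerivAt (fun y => f (s, y)) (g (s, y)) y) (z : ℝ × ℝ) :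
    HasFDerivAt (primitive f) ((ContinuousLinearMap.toSpanSingleton ℝ (f z)).coprod
      (ContinuousLinearMap.toSpanSingleton ℝ (primitive g z))) z := by
  have hspan : Continuous fun e : E => ContinuousLinearMap.toSpanSingleton ℝ e := by
    convert (ContinuousLinearMap.smulRightL ℝ ℝ E (1 : ℝ →L[ℝ] ℝ)).continuous using 1
    funext e; ext; simp
  refine (hasStrictFDerivAt_uncurry_coprod (u := z) (f := fun x y => primitive f (x, y))
    (f₁ := fun x y => ContinuousLinearMap.toSpanSingleton ℝ (f (x, y)))
    (f₂ := fun x y => ContinuousLinearMap.toSpanSingleton ℝ (primitive g (x, y)))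
    ?_ ?_ ?_ ?_).hasFDerivAt
  · refine Filter.Eventually.of_forall fun v => ?_
    have hc : Continuous fun s => f (s, v.2) := by fun_prop
    exact (intervalIntegral.integral_hasDerivAt_right (hc.intervalIntegrable _ _)
      (hc.stronglyMeasurableAtFilter _ _) hc.continuousAt).hasFDerivAt
  · exact Filter.Eventually.of_forall fun v =>
      (hasDerivAt_integral_param hf hg hfg v.1 v.2).hasFDerivAt
  · exact (hspan.comp hf).continuousAt
  · exact (hspan.comp (continuous_primitive hg)).continuousAt

/-- The partial derivatives of `primitive f` are `f` and `primitive g`. So one derivative is gained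
without `f` being `C^(k+1)`, which is what the bootstrap for the Goursat system needs. -/
lemma contDiff_primitive_succ {k : ℕ} {f g : ℝ × ℝ → E} (hf : ContDiff ℝ k f) (hg : Continuous g)
    (hfg : ∀ s y, HasDerivAt (fun y => f (s, y)) (g (s, y)) y) (hG : ContDiff ℝ k (primitive g)) :
    ContDiff ℝ (k + 1) (primitive f) := by
  have h := hasFDerivAt_primitive hf.continuous hg hfg
  refine contDiff_succ_iff_fderiv.2 ⟨fun z => (h z).differentiableAt, by simp, ?_⟩
  rw [show fderiv ℝ (primitive f) = fun z => (ContinuousLinearMap.toSpanSingleton ℝ (f z)).coprod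
    (ContinuousLinearMap.toSpanSingleton ℝ (primitive g z)) from funext fun z => (h z).fderiv]
  have e : (fun z => (ContinuousLinearMap.toSpanSingleton ℝ (f z)).coprod
      (ContinuousLinearMap.toSpanSingleton ℝ (primitive g z))) = fun z =>
      (ContinuousLinearMap.fst ℝ ℝ ℝ).smulRight (f z) +
      (ContinuousLinearMap.snd ℝ ℝ ℝ).smulRight (primitive g z) := by
    funext z; ext <;> simp
  rw [e]
  exact (contDiff_const.smulRight hf).add (contDiff_const.smulRight hG)

lemma contDiff_primitive (k : ℕ) : ∀ {f : ℝ × ℝ → E}, ContDiff ℝ k f →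
    ContDiff ℝ k (primitive f) := by
  induction k with
  | zero =>
    intro f hf
    exact contDiff_zero.2 (continuous_primitive hf.continuous)
  | succ k ih =>
    intro f hf
    have hf' : ContDiff ℝ ((k : WithTop ℕ∞) + 1) f := by exact_mod_cast hf
    have hg : ContDiff ℝ k fun z => fderiv ℝ f z (0, 1) :=
      (contDiff_succ_iff_fderiv.1 hf').2.2.clm_apply contDiff_const
    have := contDiff_primitive_succ (hf'.of_le le_self_add) hg.continuous
      (hasDerivAt_snd_of_differentiable (hf'.differentiable (by simp))) (ih hg)
    exact_mod_cast this

end PartialPrimitive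

/-! ### Smoothness of solutions of the integral Goursat system -/

section GoursatRegularity

variable {A : Type*} [NormedRing A] [NormedAlgebra ℝ A] [CompleteSpace A]

/-- The integral form of the Goursat problem in characteristic coordinates. -/
structure GoursatIntegral (q r : ℝ → A) (K₁ K₂ : ℝ × ℝ → A) : Prop where
  cont₁ : Continuous K₁
  cont₂ : Continuous K₂
  eq₁ : ∀ x y, K₁ (x, y) = ∫ s in (0 : ℝ)..x, q (s + y) * K₂ (s, y)
  eq₂ : ∀ x y, K₂ (x, y) = r x + ∫ s in (0 : ℝ)..y, q (x + s) * K₁ (x, s)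

namespace GoursatIntegral

variable {q r : ℝ → A} {K₁ K₂ : ℝ × ℝ → A}

lemma hasDerivAt₁ (h : GoursatIntegral q r K₁ K₂) (hq : Continuous q) (x y : ℝ) :
    HasDerivAt (fun x => K₁ (x, y)) (q (x + y) * K₂ (x, y)) x := by
  simp only [h.eq₁ _ y]
  have hK := h.cont₂
  have hc : Continuous fun s => q (s + y) * K₂ (s, y) := by fun_prop
  exact intervalIntegral.integral_hasDerivAt_right (hc.intervalIntegrable _ _)
      (hc.stronglyMeasurableAtFilter _ _) hc.continuousAt

lemma hasDerivAt₂ (h : GoursatIntegral q r K₁ K₂) (hq : Continuous q) (x y : ℝ) :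
    HasDerivAt (fun y => K₂ (x, y)) (q (x + y) * K₁ (x, y)) y := by
  simp only [h.eq₂ x]
  have hK := h.cont₁
  have hc : Continuous fun s => q (x + s) * K₁ (x, s) := by fun_prop
  exact (intervalIntegral.integral_hasDerivAt_right (hc.intervalIntegrable _ _)
      (hc.stronglyMeasurableAtFilter _ _) hc.continuousAt).const_add _

/-- Bootstrap: the transverse derivative of the integrand `q(s+y) K₂(s,y)` is `q' K₂ + q (q K₁)` by
the other equation, hence no rougher than what is already known. The same holds with the roles
exchanged. -/
lemma contDiff (h : GoursatIntegral q r K₁ K₂) (k : ℕ) : ContDiff ℝ k q → ContDiff ℝ k r →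
    ContDiff ℝ k K₁ ∧ ContDiff ℝ k K₂ := by
  induction k with
  | zero => exact fun _ _ => ⟨contDiff_zero.2 h.cont₁, contDiff_zero.2 h.cont₂⟩
  | succ k ih =>
    intro hq hr
    have hq1 : ContDiff ℝ ((k : WithTop ℕ∞) + 1) q := by exact_mod_cast hq
    have hr1 : ContDiff ℝ ((k : WithTop ℕ∞) + 1) r := by exact_mod_cast hr
    have hq0 : ContDiff ℝ k q := hq1.of_le le_self_add
    obtain ⟨k1, k2⟩ := ih hq0 (hr1.of_le le_self_add)
    have hdq : ContDiff ℝ k (deriv q) := (contDiff_succ_iff_deriv.1 hq1).2.2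
    have hqd : ∀ s, HasDerivAt q (deriv q s) s := fun s =>
      ((hq1.differentiable (by simp)) s).hasDerivAt
    have hK₁ : K₁ = primitive fun z => q (z.1 + z.2) * K₂ z := funext fun z => h.eq₁ z.1 z.2
    have hK₂ : K₂ = fun z => r z.1 + primitive (fun z => q (z.2 + z.1) * K₁ z.swap) z.swap :=
      funext fun z => h.eq₂ z.1 z.2
    have hsum : ContDiff ℝ k fun z : ℝ × ℝ => z.1 + z.2 := contDiff_fst.add contDiff_snd
    have hsum' : ContDiff ℝ k fun z : ℝ × ℝ => z.2 + z.1 := contDiff_snd.add contDiff_fst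
    have hswap : ∀ {n : WithTop ℕ∞}, ContDiff ℝ n fun z : ℝ × ℝ => z.swap :=
      contDiff_snd.prodMk contDiff_fst
    constructor
    · have hg : ContDiff ℝ k fun z : ℝ × ℝ => deriv q (z.1 + z.2) * K₂ z +
          q (z.1 + z.2) * (q (z.1 + z.2) * K₁ z) :=
        ((hdq.comp hsum).mul k2).add ((hq0.comp hsum).mul ((hq0.comp hsum).mul k1))
      rw [hK₁]
      have := contDiff_primitive_succ (f := fun z => q (z.1 + z.2) * K₂ z)
        ((hq0.comp hsum).mul k2) hg.continuous
        (fun s y => by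
          have h1 : HasDerivAt (fun y => q (s + y)) (deriv q (s + y)) y :=
            (hqd (s + y)).comp_const_add s y
          exact h1.mul (h.hasDerivAt₂ hq0.continuous s y)) (contDiff_primitive k hg)
      exact_mod_cast this
    · have hg : ContDiff ℝ k fun z : ℝ × ℝ => deriv q (z.2 + z.1) * K₁ z.swap +
          q (z.2 + z.1) * (q (z.2 + z.1) * K₂ z.swap) :=
        ((hdq.comp hsum').mul (k1.comp hswap)).add
          ((hq0.comp hsum').mul ((hq0.comp hsum').mul (k2.comp hswap)))
      have := contDiff_primitive_succ (f := fun z => q (z.2 + z.1) * K₁ z.swap)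
        ((hq0.comp hsum').mul (k1.comp hswap)) hg.continuous
        (fun s y => by
          have h1 : HasDerivAt (fun y => q (y + s)) (deriv q (y + s)) y :=
            (hqd (y + s)).comp_add_const y s
          exact h1.mul (h.hasDerivAt₁ hq0.continuous y s)) (contDiff_primitive k hg)
      rw [hK₂]
      have h3 : ContDiff ℝ ((k : WithTop ℕ∞) + 1) fun z : ℝ × ℝ => r z.1 +
          primitive (fun z => q (z.2 + z.1) * K₁ z.swap) z.swap :=
        (hr1.comp contDiff_fst).add (this.comp hswap)
      exact_mod_cast h3

end GoursatIntegral

end GoursatRegularity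

end DiracNSBF

namespace DiracNSBF

/-! ### Extending a function from an interval to the line -/

section Extension

variable {E : Type*} [NormedAddCommGroup E] [NormedSpace ℝ E] [CompleteSpace E]

/-- The top derivative is extended by constants and then integrated back `k` times. -/
lemma exists_contDiff_extension {b : ℝ} (hb : 0 < b) (k : ℕ) : ∀ {f : ℝ → E},
    ContDiffOn ℝ k f (Set.Icc 0 b) → ∃ F : ℝ → E, ContDiff ℝ k F ∧ Set.EqOn F f (Set.Icc 0 b) := by
  induction k with
  | zero =>
    intro f hf
    refine ⟨Set.IccExtend hb.le ((Set.Icc 0 b).domRestrict f), contDiff_zero.2 ?_, fun x hx => ?_⟩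
    · exact (continuousOn_iff_continuous_domRestrict.1 hf.continuousOn).Icc_extend'
    · rw [Set.IccExtend_of_mem _ _ hx]; rfl
  | succ k ih =>
    intro f hf
    have hf' : ContDiffOn ℝ ((k : WithTop ℕ∞) + 1) f (Set.Icc 0 b) := by exact_mod_cast hf
    have hu := uniqueDiffOn_Icc hb
    obtain ⟨hd, -, hdk⟩ := (contDiffOn_succ_iff_derivWithin hu).1 hf'
    obtain ⟨G, hG, hGe⟩ := ih hdk
    have hGc := hG.continuous
    have hF : ∀ x, HasDerivAt (fun x => f 0 + ∫ s in (0 : ℝ)..x, G s) (G x) x := fun x =>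
      (intervalIntegral.integral_hasDerivAt_right (hGc.intervalIntegrable _ _)
        (hGc.stronglyMeasurableAtFilter _ _) hGc.continuousAt).const_add _
    refine ⟨fun x => f 0 + ∫ s in (0 : ℝ)..x, G s, ?_, fun x hx => ?_⟩
    · have : ContDiff ℝ ((k : WithTop ℕ∞) + 1) (fun x => f 0 + ∫ s in (0 : ℝ)..x, G s) := by
        refine contDiff_succ_iff_deriv.2 ⟨fun x => (hF x).differentiableAt, by simp, ?_⟩
        rw [show deriv (fun x => f 0 + ∫ s in (0 : ℝ)..x, G s) = G from funext fun x => (hF x).deriv]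
        exact hG
      exact_mod_cast this
    · have h := (convex_Icc (0 : ℝ) b).norm_image_sub_le_of_norm_hasDerivWithin_le (C := 0)
        (f := fun x => (f 0 + ∫ s in (0 : ℝ)..x, G s) - f x) (f' := fun _ => 0)
        (fun y hy => ((hF y).hasDerivWithinAt.sub (hd y hy).hasDerivWithinAt).congr_deriv
          (by rw [hGe hy, sub_self])) (by simp) (Set.left_mem_Icc.2 hb.le) hx
      simp only [zero_mul, norm_le_zero_iff, intervalIntegral.integral_same, add_zero, sub_self,
        sub_zero] at h
      exact sub_eq_zero.1 h

/-- A bump function cuts the extension off; global boundedness lets the contraction run on the whole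
plane. -/
lemma exists_bounded_contDiff_extension {b : ℝ} (hb : 0 < b) (k : ℕ) {f : ℝ → E}
    (hf : ContDiffOn ℝ k f (Set.Icc 0 b)) :
    ∃ F : ℝ → E, ContDiff ℝ k F ∧ Set.EqOn F f (Set.Icc 0 b) ∧ ∃ c, ∀ x, ‖F x‖ ≤ c := by
  obtain ⟨F, hF, hFe⟩ := exists_contDiff_extension hb k hf
  let χ : ContDiffBump (0 : ℝ) := ⟨b, b + 1, hb, by linarith⟩
  have hc : ContDiff ℝ k fun x => χ x • F x := χ.contDiff.smul hF
  refine ⟨fun x => χ x • F x, hc, fun x hx => ?_, ?_⟩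
  · have : χ x = 1 := χ.one_of_mem_closedBall (by
      rw [Metric.mem_closedBall, Real.dist_eq, sub_zero, abs_of_nonneg hx.1]; exact hx.2)
    simp only [this, one_smul]
    exact hFe hx
  · exact hc.continuous.bounded_above_of_compact_support χ.hasCompactSupport.smul_right

end Extension

/-! ### Exponential weights -/

section Weights

lemma integral_exp_mul_abs {γ : ℝ} (hγ : γ ≠ 0) {x : ℝ} (hx : 0 ≤ x) :
    ∫ s in (0 : ℝ)..x, Real.exp (γ * |s|) = (Real.exp (γ * x) - 1) / γ := by
  have h : ∀ s ∈ Set.uIcc 0 x, Real.exp (γ * |s|) = Real.exp (γ * s) := by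
    intro s hs
    rw [Set.uIcc_of_le hx] at hs
    rw [abs_of_nonneg hs.1]
  rw [intervalIntegral.integral_congr h,
    intervalIntegral.integral_comp_mul_left (fun s => Real.exp s) hγ, integral_exp]
  simp [div_eq_inv_mul]

lemma integral_neg_exp_mul_abs {γ : ℝ} (hγ : γ ≠ 0) {x : ℝ} (hx : 0 ≤ x) :
    ∫ s in (-x)..0, Real.exp (γ * |s|) = (Real.exp (γ * x) - 1) / γ := by
  have h := intervalIntegral.integral_comp_neg (a := 0) (b := x) (fun s => Real.exp (γ * |s|))
  simp only [abs_neg, neg_zero] at h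
  rw [← h, integral_exp_mul_abs hγ hx]

lemma abs_integral_exp_mul_abs_le {γ : ℝ} (hγ : 0 < γ) (x : ℝ) :
    |∫ s in (0 : ℝ)..x, Real.exp (γ * |s|)| ≤ Real.exp (γ * |x|) / γ := by
  have key : ∀ y : ℝ, 0 ≤ y → |(Real.exp (γ * y) - 1) / γ| ≤ Real.exp (γ * y) / γ := by
    intro y hy
    have : 1 ≤ Real.exp (γ * y) := Real.one_le_exp (by positivity)
    rw [abs_of_nonneg (div_nonneg (by linarith) hγ.le)]
    gcongr
    linarith
  rcases le_total 0 x with hx | hx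
  · rw [integral_exp_mul_abs hγ.ne' hx, abs_of_nonneg hx]; exact key x hx
  · have h := integral_neg_exp_mul_abs hγ.ne' (neg_nonneg.2 hx)
    rw [neg_neg] at h
    rw [intervalIntegral.integral_symm, h, abs_neg, abs_of_nonpos hx]
    exact key _ (neg_nonneg.2 hx)

/-- Integration from `0` gains `1/γ` in the weighted norm; this smallness drives both existence and
uniqueness. -/
lemma norm_integral_le_of_norm_le_exp {E : Type*} [NormedAddCommGroup E] [NormedSpace ℝ E]
    {γ : ℝ} (hγ : 0 < γ) {φ : ℝ → E} {m a x : ℝ} (hm : 0 ≤ m)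
    (h : ∀ s ∈ Set.uIoc 0 x, ‖φ s‖ ≤ m * Real.exp (γ * (|s| + a))) :
    ‖∫ s in (0 : ℝ)..x, φ s‖ ≤ m / γ * Real.exp (γ * (|x| + a)) := by
  have hc : Continuous fun s : ℝ => m * Real.exp (γ * (|s| + a)) := by fun_prop
  refine (intervalIntegral.norm_integral_le_abs_of_norm_le
    ((MeasureTheory.ae_restrict_iff' measurableSet_uIoc).2
      (Filter.Eventually.of_forall h)) (hc.intervalIntegrable _ _)).trans ?_
  have e : ∀ s : ℝ, m * Real.exp (γ * (|s| + a)) = m * Real.exp (γ * a) * Real.exp (γ * |s|) := by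
    intro s; rw [mul_add, Real.exp_add]; ring
  simp only [e]
  rw [intervalIntegral.integral_const_mul, abs_mul, abs_of_nonneg (by positivity)]
  calc _ ≤ m * Real.exp (γ * a) * (Real.exp (γ * |x|) / γ) := by
        gcongr; exact abs_integral_exp_mul_abs_le hγ x
    _ = _ := by rw [mul_add γ, Real.exp_add]; ring

end Weights

/-! ### Existence for the integral Goursat system -/

section GoursatExistence

variable {A : Type*} [NormedRing A] [NormedAlgebra ℝ A]

open BoundedContinuousFunction

/-- One weighted Picard step for the integral Goursat problem. -/
noncomputable def picard (γ : ℝ) (q r : ℝ → A) (h : ℝ × ℝ → A × A) (z : ℝ × ℝ) : A × A :=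
  (Real.exp (-(γ * (|z.1| + |z.2|))) •
      ∫ s in (0 : ℝ)..z.1, Real.exp (γ * (|s| + |z.2|)) • (q (s + z.2) * (h (s, z.2)).2),
    Real.exp (-(γ * (|z.1| + |z.2|))) • (r z.1 +
      ∫ s in (0 : ℝ)..z.2, Real.exp (γ * (|s| + |z.1|)) • (q (z.1 + s) * (h (z.1, s)).1)))

lemma continuous_picard (γ : ℝ) {q r : ℝ → A} (hq : Continuous q) (hr : Continuous r)
    {h : ℝ × ℝ → A × A} (hh : Continuous h) : Continuous (picard γ q r h) := by
  have h1 : Continuous fun z : ℝ × ℝ =>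
      ∫ s in (0 : ℝ)..z.1, Real.exp (γ * (|s| + |z.2|)) • (q (s + z.2) * (h (s, z.2)).2) :=
    intervalIntegral.continuous_parametric_intervalIntegral_of_continuous
      (f := fun (z : ℝ × ℝ) s => Real.exp (γ * (|s| + |z.2|)) • (q (s + z.2) * (h (s, z.2)).2))
      (by fun_prop) continuous_fst
  have h2 : Continuous fun z : ℝ × ℝ =>
      ∫ s in (0 : ℝ)..z.2, Real.exp (γ * (|s| + |z.1|)) • (q (z.1 + s) * (h (z.1, s)).1) :=
    intervalIntegral.continuous_parametric_intervalIntegral_of_continuous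
      (f := fun (z : ℝ × ℝ) s => Real.exp (γ * (|s| + |z.1|)) • (q (z.1 + s) * (h (z.1, s)).1))
      (by fun_prop) continuous_snd
  unfold picard
  fun_prop

lemma norm_weighted_integral_le {γ c m : ℝ} (hγ : 0 < γ) (hm : 0 ≤ m) (hc : 0 ≤ c) {f g : ℝ → A}
    (hf : ∀ s, ‖f s‖ ≤ c) (hg : ∀ s, ‖g s‖ ≤ m) (x y : ℝ) :
    ‖Real.exp (-(γ * (|x| + |y|))) •
      ∫ s in (0 : ℝ)..x, Real.exp (γ * (|s| + |y|)) • (f s * g s)‖ ≤ c * m / γ := by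
  have h := norm_integral_le_of_norm_le_exp (φ := fun s =>
    Real.exp (γ * (|s| + |y|)) • (f s * g s)) (m := c * m) (a := |y|) (x := x) hγ
    (by positivity) (fun s _ => by
      rw [norm_smul, Real.norm_eq_abs, abs_of_pos (Real.exp_pos _), mul_comm]
      gcongr
      exact (norm_mul_le _ _).trans (mul_le_mul (hf s) (hg s) (norm_nonneg _) hc))
  rw [norm_smul, Real.norm_eq_abs, abs_of_pos (Real.exp_pos _)]
  calc _ ≤ Real.exp (-(γ * (|x| + |y|))) * (c * m / γ * Real.exp (γ * (|x| + |y|))) := by gcongr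
    _ = c * m / γ := by rw [Real.exp_neg]; field_simp

/-- The unknown is the pair multiplied by `exp(-γ(|x|+|y|))`, a bounded continuous function on the
plane. There the Picard map has Lipschitz constant at most `c/γ`. -/
theorem exists_goursatIntegral [CompleteSpace A] {q r : ℝ → A} (hq : Continuous q) (hr : Continuous r)
    {c d : ℝ} (hqc : ∀ x, ‖q x‖ ≤ c) (hrd : ∀ x, ‖r x‖ ≤ d) :
    ∃ K₁ K₂ : ℝ × ℝ → A, GoursatIntegral q r K₁ K₂ := by
  have hc : 0 ≤ c := (norm_nonneg _).trans (hqc 0)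
  have hd : 0 ≤ d := (norm_nonneg _).trans (hrd 0)
  -- This makes `c/γ ≤ 1/2`, and the `+ 1` keeps `γ` positive when `c = 0`.
  set γ : ℝ := 2 * c + 1 with hγdef
  have hγ : 0 < γ := by positivity
  have hexp : ∀ z : ℝ × ℝ, Real.exp (-(γ * (|z.1| + |z.2|))) ≤ 1 := fun z =>
    Real.exp_le_one_iff.2 (neg_nonpos.2 (by positivity))
  have hbound : ∀ (h : (ℝ × ℝ) →ᵇ A × A) z, ‖picard γ q r h z‖ ≤ d + c * ‖h‖ / γ := by
    intro h z
    have n1 : ∀ z, ‖(h z).1‖ ≤ ‖h‖ := fun z => (norm_fst_le _).trans (h.norm_coe_le_norm z)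
    have n2 : ∀ z, ‖(h z).2‖ ≤ ‖h‖ := fun z => (norm_snd_le _).trans (h.norm_coe_le_norm z)
    refine norm_prod_le_iff.2 ⟨?_, ?_⟩
    · exact (norm_weighted_integral_le hγ (norm_nonneg h) hc (fun s => hqc (s + z.2))
        (fun s => n2 (s, z.2)) z.1 z.2).trans (by linarith)
    · simp only [picard]
      rw [smul_add]
      refine (norm_add_le _ _).trans (add_le_add ?_ ?_)
      · rw [norm_smul, Real.norm_eq_abs, abs_of_pos (Real.exp_pos _)]
        exact (mul_le_mul (hexp z) (hrd _) (norm_nonneg _) zero_le_one).trans (one_mul d).le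
      · rw [add_comm |z.1|]
        exact norm_weighted_integral_le hγ (norm_nonneg h) hc (fun s => hqc (z.1 + s))
          (fun s => n1 (z.1, s)) z.2 z.1
  let T : ((ℝ × ℝ) →ᵇ A × A) → ((ℝ × ℝ) →ᵇ A × A) := fun h =>
    ofNormedAddCommGroup (picard γ q r h) (continuous_picard γ hq hr h.continuous) _ (hbound h)
  have hT : ContractingWith (1 / 2) T := by
    refine ⟨by norm_num, LipschitzWith.of_dist_le_mul fun h k => ?_⟩
    rw [dist_le (by positivity)]
    intro z
    have n1 : ∀ z, ‖(h z).1 - (k z).1‖ ≤ dist h k := fun z =>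
      (norm_fst_le (h z - k z)).trans ((dist_eq_norm (h z) (k z)).symm.le.trans (dist_coe_le_dist z))
    have n2 : ∀ z, ‖(h z).2 - (k z).2‖ ≤ dist h k := fun z =>
      (norm_snd_le (h z - k z)).trans ((dist_eq_norm (h z) (k z)).symm.le.trans (dist_coe_le_dist z))
    have hle : c * dist h k / γ ≤ ((1 / 2 : NNReal) : ℝ) * dist h k := by
      have : c / γ ≤ 1 / 2 := by rw [div_le_div_iff₀ hγ two_pos]; linarith
      push_cast
      rw [mul_div_right_comm]
      gcongr
    have hh := h.continuous
    have hk := k.continuous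
    rw [dist_eq_norm]
    refine norm_prod_le_iff.2 ⟨?_, ?_⟩
    · change ‖(picard γ q r h z).1 - (picard γ q r k z).1‖ ≤ _
      simp only [picard]
      rw [← smul_sub, ← intervalIntegral.integral_sub]
      · simp only [← smul_sub, ← mul_sub]
        exact (norm_weighted_integral_le hγ dist_nonneg hc (fun s => hqc (s + z.2))
          (fun s => n2 (s, z.2)) z.1 z.2).trans hle
      all_goals exact Continuous.intervalIntegrable (by fun_prop) _ _
    · change ‖(picard γ q r h z).2 - (picard γ q r k z).2‖ ≤ _
      simp only [picard]
      rw [← smul_sub, add_sub_add_left_eq_sub, ← intervalIntegral.integral_sub]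
      · simp only [← smul_sub, ← mul_sub]
        rw [add_comm |z.1|]
        exact (norm_weighted_integral_le hγ dist_nonneg hc (fun s => hqc (z.1 + s))
          (fun s => n1 (z.1, s)) z.2 z.1).trans hle
      all_goals exact Continuous.intervalIntegrable (by fun_prop) _ _
  set h := ContractingWith.fixedPoint T hT
  have hfix : ∀ z, picard γ q r h z = h z := fun z =>
    congrArg (fun g : (ℝ × ℝ) →ᵇ A × A => g z) hT.fixedPoint_isFixedPt
  have hh := h.continuous
  have hcancel : ∀ (z : ℝ × ℝ) (a : A), Real.exp (γ * (|z.1| + |z.2|)) •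
      Real.exp (-(γ * (|z.1| + |z.2|))) • a = a := by
    intro z a
    rw [smul_smul, ← Real.exp_add, add_neg_cancel, Real.exp_zero, one_smul]
  refine ⟨fun z => Real.exp (γ * (|z.1| + |z.2|)) • (h z).1,
    fun z => Real.exp (γ * (|z.1| + |z.2|)) • (h z).2, by fun_prop, by fun_prop, fun x y => ?_,
    fun x y => ?_⟩
  · simp only [mul_smul_comm]
    rw [← hfix (x, y)]
    exact hcancel (x, y) _
  · simp only [mul_smul_comm, add_comm |x|]
    rw [← hfix (x, y), add_comm |y|]
    exact hcancel (x, y) _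

end GoursatExistence

/-! ### Uniqueness for the integral Goursat system -/

section GoursatUniqueness

variable {A : Type*} [NormedRing A] [NormedAlgebra ℝ A]

/-- The weighted sup norm attains a maximum `m` on the compact domain, and the equations give `m ≤
(c/γ) m` with `c/γ < 1`. The integration segments stay in the domain, so nothing is needed outside
it. -/
theorem goursat_unique {b : ℝ} {q : ℝ → A} (hq : Continuous q) {k₁ k₂ : ℝ × ℝ → A}
    (h1 : ContinuousOn k₁ {z | 0 ≤ z.1 ∧ 0 ≤ z.2 ∧ z.1 + z.2 ≤ b})
    (h2 : ContinuousOn k₂ {z | 0 ≤ z.1 ∧ 0 ≤ z.2 ∧ z.1 + z.2 ≤ b})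
    (e1 : ∀ x y, 0 ≤ x → 0 ≤ y → x + y ≤ b → k₁ (x, y) = ∫ s in (0 : ℝ)..x, q (s + y) * k₂ (s, y))
    (e2 : ∀ x y, 0 ≤ x → 0 ≤ y → x + y ≤ b → k₂ (x, y) = ∫ s in (0 : ℝ)..y, q (x + s) * k₁ (x, s))
    {x y : ℝ} (hx : 0 ≤ x) (hy : 0 ≤ y) (hxy : x + y ≤ b) : k₁ (x, y) = 0 ∧ k₂ (x, y) = 0 := by
  set D : Set (ℝ × ℝ) := {z | 0 ≤ z.1 ∧ 0 ≤ z.2 ∧ z.1 + z.2 ≤ b} with hD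
  have hDc : IsCompact D := by
    refine (isCompact_Icc (a := ((0 : ℝ), (0 : ℝ))) (b := (b, b))).of_isClosed_subset ?_ ?_
    · exact (isClosed_le continuous_const continuous_fst).inter
        ((isClosed_le continuous_const continuous_snd).inter
          (isClosed_le (continuous_fst.add continuous_snd) continuous_const))
    · rintro ⟨u, v⟩ ⟨hu, hv, huv⟩
      simp only at hu hv huv
      exact ⟨⟨hu, hv⟩, ⟨by simp only; linarith, by simp only; linarith⟩⟩
  obtain ⟨c, hc⟩ := (isCompact_Icc (a := (0 : ℝ)) (b := b)).exists_bound_of_continuousOn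
    hq.continuousOn
  have hc0 : 0 ≤ c := (norm_nonneg _).trans (hc 0 ⟨le_rfl, by linarith⟩)
  set γ : ℝ := 2 * c + 1 with hγdef
  have hγ : 0 < γ := by positivity
  obtain ⟨w, hw, hmax⟩ := hDc.exists_isMaxOn ⟨(x, y), hx, hy, hxy⟩
    (f := fun z => Real.exp (-(γ * (z.1 + z.2))) * max ‖k₁ z‖ ‖k₂ z‖)
    ((by fun_prop : Continuous fun z : ℝ × ℝ => Real.exp (-(γ * (z.1 + z.2)))).continuousOn.mul
      (h1.norm.sup h2.norm))
  set m : ℝ := Real.exp (-(γ * (w.1 + w.2))) * max ‖k₁ w‖ ‖k₂ w‖ with hm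
  have hm0 : 0 ≤ m := by positivity
  have hle : ∀ z ∈ D, max ‖k₁ z‖ ‖k₂ z‖ ≤ m * Real.exp (γ * (z.1 + z.2)) := by
    intro z hz
    have : Real.exp (-(γ * (z.1 + z.2))) * max ‖k₁ z‖ ‖k₂ z‖ ≤ m := hmax hz
    rw [Real.exp_neg, inv_mul_le_iff₀ (Real.exp_pos _), mul_comm] at this
    exact this
  have b1 : ∀ z ∈ D, ‖k₁ z‖ ≤ c * m / γ * Real.exp (γ * (z.1 + z.2)) := by
    rintro ⟨x, y⟩ ⟨hx, hy, hxy⟩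
    simp only at hx hy hxy ⊢
    rw [e1 x y hx hy hxy]
    have := norm_integral_le_of_norm_le_exp (φ := fun s => q (s + y) * k₂ (s, y)) (m := c * m)
      (a := y) (x := x) hγ (by positivity) (fun s hs => by
        rw [Set.uIoc_of_le hx] at hs
        have hsD : (s, y) ∈ D := ⟨hs.1.le, hy, by simp only; linarith [hs.2]⟩
        have h3 := (le_max_right _ _).trans (hle _ hsD)
        rw [abs_of_pos hs.1, mul_assoc]
        exact (norm_mul_le _ _).trans (mul_le_mul (hc _ ⟨by linarith [hs.1], by linarith [hs.2]⟩) h3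
          (norm_nonneg _) hc0))
    rwa [abs_of_nonneg hx] at this
  have b2 : ∀ z ∈ D, ‖k₂ z‖ ≤ c * m / γ * Real.exp (γ * (z.1 + z.2)) := by
    rintro ⟨x, y⟩ ⟨hx, hy, hxy⟩
    simp only at hx hy hxy ⊢
    rw [e2 x y hx hy hxy]
    have := norm_integral_le_of_norm_le_exp (φ := fun s => q (x + s) * k₁ (x, s)) (m := c * m)
      (a := x) (x := y) hγ (by positivity) (fun s hs => by
        rw [Set.uIoc_of_le hy] at hs
        have hsD : (x, s) ∈ D := ⟨hx, hs.1.le, by simp only; linarith [hs.2]⟩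
        have h3 := (le_max_left _ _).trans (hle _ hsD)
        rw [abs_of_pos hs.1, mul_assoc, add_comm s x]
        exact (norm_mul_le _ _).trans (mul_le_mul (hc _ ⟨by linarith [hs.1], by linarith [hs.2]⟩) h3
          (norm_nonneg _) hc0))
    rwa [abs_of_nonneg hy, add_comm y x] at this
  have hmle : m ≤ c * m / γ := by
    have : m ≤ Real.exp (-(γ * (w.1 + w.2))) * (c * m / γ * Real.exp (γ * (w.1 + w.2))) :=
      mul_le_mul_of_nonneg_left (max_le (b1 w hw) (b2 w hw)) (Real.exp_pos _).le
    rwa [mul_comm (c * m / γ), ← mul_assoc, ← Real.exp_add, neg_add_cancel, Real.exp_zero,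
      one_mul] at this
  have hm00 : m = 0 := by
    rw [le_div_iff₀ hγ] at hmle
    nlinarith
  have h := hle (x, y) ⟨hx, hy, hxy⟩
  rw [hm00, zero_mul] at h
  exact ⟨norm_le_zero_iff.1 ((le_max_left _ _).trans h),
    norm_le_zero_iff.1 ((le_max_right _ _).trans h)⟩

end GoursatUniqueness

end DiracNSBF

namespace DiracNSBF

/-! ### Splitting into parts commuting and anticommuting with `J` -/

section Projections

variable {A : Type*} [NormedRing A] [NormedAlgebra ℝ A]

/-- For `J² = -1`, the projection onto the elements commuting with `J`. -/
noncomputable def commProj (J : A) : A →L[ℝ] A :=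
  (1 / 2 : ℝ) • (ContinuousLinearMap.id ℝ A - ContinuousLinearMap.mulLeftRight ℝ A J J)

/-- For `J² = -1`, the projection onto the elements anticommuting with `J`. -/
noncomputable def anticommProj (J : A) : A →L[ℝ] A :=
  (1 / 2 : ℝ) • (ContinuousLinearMap.id ℝ A + ContinuousLinearMap.mulLeftRight ℝ A J J)

variable {J : A}

lemma commProj_apply (X : A) : commProj J X = (1 / 2 : ℝ) • (X - J * X * J) := by
  simp [commProj]

lemma anticommProj_apply (X : A) : anticommProj J X = (1 / 2 : ℝ) • (X + J * X * J) := by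
  simp [anticommProj]

lemma commProj_add_anticommProj (X : A) : commProj J X + anticommProj J X = X := by
  rw [commProj_apply, anticommProj_apply]; module

lemma mul_commProj (hJ : J * J = -1) (X : A) : J * commProj J X = commProj J X * J := by
  have h1 : J * (J * X * J) = -(X * J) := by
    rw [← mul_assoc, ← mul_assoc, hJ]; noncomm_ring
  have h2 : (J * X * J) * J = -(J * X) := by
    rw [mul_assoc, hJ]; noncomm_ring
  rw [commProj_apply, mul_smul_comm, smul_mul_assoc, mul_sub, sub_mul, h1, h2]
  congr 1; abel

lemma mul_anticommProj (hJ : J * J = -1) (X : A) :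
    J * anticommProj J X = -(anticommProj J X * J) := by
  have h1 : J * (J * X * J) = -(X * J) := by
    rw [← mul_assoc, ← mul_assoc, hJ]; noncomm_ring
  have h2 : (J * X * J) * J = -(J * X) := by
    rw [mul_assoc, hJ]; noncomm_ring
  rw [anticommProj_apply, mul_smul_comm, smul_mul_assoc, mul_add, add_mul, h1, h2, ← smul_neg]
  congr 1; abel

lemma commProj_eq_self (hJ : J * J = -1) {X : A} (h : J * X = X * J) : commProj J X = X := by
  rw [commProj_apply, h, mul_assoc, hJ]
  simp only [mul_neg, mul_one]
  module

lemma anticommProj_eq_self (hJ : J * J = -1) {X : A} (h : J * X = -(X * J)) :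
    anticommProj J X = X := by
  rw [anticommProj_apply, h, neg_mul, mul_assoc, hJ]
  simp only [mul_neg, mul_one]
  module

lemma commProj_eq_zero (hJ : J * J = -1) {X : A} (h : J * X = -(X * J)) : commProj J X = 0 := by
  have := commProj_add_anticommProj (J := J) X
  rwa [anticommProj_eq_self hJ h, add_eq_right] at this

lemma anticommProj_eq_zero (hJ : J * J = -1) {X : A} (h : J * X = X * J) :
    anticommProj J X = 0 := by
  have := commProj_add_anticommProj (J := J) X
  rwa [commProj_eq_self hJ h, add_eq_left] at this

/-- Because `J (q X) J = -q (J X J)`, left multiplication by `q` exchanges the two parts. This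
couples `K₁` and `K₂`. -/
lemma commProj_mul {q : A} (hq : J * q = -(q * J)) (X : A) :
    commProj J (q * X) = q * anticommProj J X := by
  rw [commProj_apply, anticommProj_apply, ← mul_assoc, hq]
  simp only [mul_smul_comm, mul_add, neg_mul, mul_assoc, sub_neg_eq_add]

lemma anticommProj_mul {q : A} (hq : J * q = -(q * J)) (X : A) :
    anticommProj J (q * X) = q * commProj J X := by
  rw [commProj_apply, anticommProj_apply, ← mul_assoc, hq]
  simp only [mul_smul_comm, mul_add, mul_neg, neg_mul, mul_assoc, sub_eq_add_neg]

/-- The first-order system `J X + Y J = -Q Z` in characteristic form. -/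
lemma commProj_add_of_system (hJ : J * J = -1) {Q : A} (hQ : J * Q = -(Q * J)) {X Y Z : A}
    (h : J * X + Y * J = -(Q * Z)) : commProj J (X + Y) = J * Q * anticommProj J Z := by
  -- The system is multiplied by `-J` once from the left and once from the right; adding the results
  -- assembles `X + Y`.
  have h1 : X - J * (Y * J) = J * (Q * Z) := by
    have := congrArg (fun W => -(J * W)) h
    simp only [mul_add, mul_neg, neg_neg, neg_add, ← mul_assoc J J, hJ, neg_mul, one_mul] at this
    rw [← this]; abel
  have h2 : Y - J * (X * J) = J * (Q * (J * Z * J)) := by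
    have := congrArg (fun W => -(W * J)) h
    simp only [add_mul, neg_mul, neg_neg, neg_add, mul_assoc, hJ, mul_neg, mul_one] at this
    rw [← mul_assoc J Q, hQ, neg_mul, mul_assoc Q J, mul_assoc J Z, ← mul_assoc J J, hJ, neg_mul,
      one_mul, mul_neg, neg_neg, ← this]
    abel
  have h3 := congrArg₂ (· + ·) h1 h2
  simp only [← mul_add] at h3
  rw [commProj_apply, anticommProj_apply, mul_smul_comm, mul_assoc J Q, ← h3]
  congr 1
  simp only [mul_add, add_mul, mul_assoc]
  abel

/-- Subtracting the two multiplied equations instead of adding them gives the other characteristic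
direction. -/
lemma anticommProj_sub_of_system (hJ : J * J = -1) {Q : A} (hQ : J * Q = -(Q * J)) {X Y Z : A}
    (h : J * X + Y * J = -(Q * Z)) : anticommProj J (X - Y) = J * Q * commProj J Z := by
  have h1 : X - J * (Y * J) = J * (Q * Z) := by
    have := congrArg (fun W => -(J * W)) h
    simp only [mul_add, mul_neg, neg_neg, neg_add, ← mul_assoc J J, hJ, neg_mul, one_mul] at this
    rw [← this]; abel
  have h2 : Y - J * (X * J) = J * (Q * (J * Z * J)) := by
    have := congrArg (fun W => -(W * J)) h
    simp only [add_mul, neg_mul, neg_neg, neg_add, mul_assoc, hJ, mul_neg, mul_one] at this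
    rw [← mul_assoc J Q, hQ, neg_mul, mul_assoc Q J, mul_assoc J Z, ← mul_assoc J J, hJ, neg_mul,
      one_mul, mul_neg, neg_neg, ← this]
    abel
  have h3 := congrArg₂ (· - ·) h1 h2
  simp only [← mul_sub] at h3
  rw [commProj_apply, anticommProj_apply, mul_smul_comm, mul_assoc J Q, ← h3]
  congr 1
  simp only [mul_sub, sub_mul, mul_assoc]
  abel

/-- The contraction yields components with no symmetry. Projecting keeps the equations, since `q`
exchanges the parts, and provides the commutation rules with `J`. -/
lemma GoursatIntegral.project [CompleteSpace A] {q r : ℝ → A} {K₁ K₂ : ℝ × ℝ → A}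
    (h : GoursatIntegral q r K₁ K₂) (hJ : J * J = -1) (hqc : Continuous q)
    (hq : ∀ x, J * q x = -(q x * J)) (hr : ∀ x, J * r x = -(r x * J)) :
    GoursatIntegral q r (fun z => commProj J (K₁ z)) (fun z => anticommProj J (K₂ z)) := by
  have c1 := h.cont₁
  have c2 := h.cont₂
  refine ⟨by fun_prop, by fun_prop, fun x y => ?_, fun x y => ?_⟩
  · simp only [h.eq₁, ← commProj_mul (hq _)]
    exact ((commProj J).intervalIntegral_comp_comm
      (Continuous.intervalIntegrable (by fun_prop) _ _)).symm
  · simp only [h.eq₂, ← anticommProj_mul (hq _), map_add, anticommProj_eq_self hJ (hr x)]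
    congr 1
    exact ((anticommProj J).intervalIntegral_comp_comm
      (Continuous.intervalIntegrable (by fun_prop) _ _)).symm

end Projections

/-! ### Construction of a kernel on the whole plane -/

section Kernel

/-- A kernel solving the Goursat problem on the whole plane, `C^n`. -/
structure IsGlobalKernel (n : WithTop ℕ∞) (Q : ℝ → M2) (K : ℝ × ℝ → M2) : Prop where
  contDiff : ContDiff ℝ n K
  pde : ∀ z, B * fderiv ℝ K z (1, 0) + fderiv ℝ K z (0, 1) * B = -(Q z.1 * K z)
  goursat_diag : ∀ x, B * K (x, x) - K (x, x) * B = -Q x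
  goursat_antidiag : ∀ x, B * K (x, -x) + K (x, -x) * B = 0

lemma hasDerivAt_fderiv_fst {E : Type*} [NormedAddCommGroup E] [NormedSpace ℝ E]
    {f : ℝ × ℝ → E} {z : ℝ × ℝ} (hf : DifferentiableAt ℝ f z) :
    HasDerivAt (fun x => f (x, z.2)) (fderiv ℝ f z (1, 0)) z.1 :=
  HasFDerivAt.comp_hasDerivAt (l := f) (f := fun x => (x, z.2)) z.1 hf.hasFDerivAt
    ((hasDerivAt_id z.1).prodMk (hasDerivAt_const z.1 z.2))

lemma hasDerivAt_fderiv_snd {E : Type*} [NormedAddCommGroup E] [NormedSpace ℝ E]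
    {f : ℝ × ℝ → E} {z : ℝ × ℝ} (hf : DifferentiableAt ℝ f z) :
    HasDerivAt (fun y => f (z.1, y)) (fderiv ℝ f z (0, 1)) z.2 :=
  HasFDerivAt.comp_hasDerivAt (l := f) (f := fun y => (z.1, y)) z.2 hf.hasFDerivAt
    ((hasDerivAt_const z.2 z.1).prodMk (hasDerivAt_id z.2))

/-- Characteristic coordinates `((x + t) / 2, (x - t) / 2)`. -/
noncomputable def charCoord : ℝ × ℝ →L[ℝ] ℝ × ℝ :=
  ((1 / 2 : ℝ) • (ContinuousLinearMap.fst ℝ ℝ ℝ + ContinuousLinearMap.snd ℝ ℝ ℝ)).prod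
    ((1 / 2 : ℝ) • (ContinuousLinearMap.fst ℝ ℝ ℝ - ContinuousLinearMap.snd ℝ ℝ ℝ))

lemma charCoord_apply (x t : ℝ) : charCoord (x, t) = ((x + t) / 2, (x - t) / 2) := by
  ext <;> simp [charCoord] <;> ring

/-- The kernel is `K₁ + K₂` in characteristic coordinates. The commutation rules reduce `B K_x + K_t
B` to `B (∂_1 K₁ + ∂_2 K₂) = B·BQ·(K₂ + K₁) = -QK`. On the diagonal only `K₂` survives the
commutator with `B`, which forces `r = BQ/2`. -/
theorem exists_globalKernel (p : ℕ) {Q : ℝ → M2} (hQ : ContDiff ℝ ((p : WithTop ℕ∞) + 1) Q)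
    (hQB : ∀ x, B * Q x = -(Q x * B)) {c : ℝ} (hc : ∀ x, ‖Q x‖ ≤ c) :
    ∃ K, IsGlobalKernel ((p : WithTop ℕ∞) + 1) Q K := by
  set q : ℝ → M2 := fun x => B * Q x with hqdef
  set r : ℝ → M2 := fun x => (1 / 2 : ℝ) • q x with hrdef
  have hq : ContDiff ℝ ((p : WithTop ℕ∞) + 1) q := contDiff_const.mul hQ
  have hr : ContDiff ℝ ((p : WithTop ℕ∞) + 1) r := hq.const_smul _
  have hqB : ∀ x, B * q x = -(q x * B) := by
    intro x
    simp only [q]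
    rw [mul_assoc, ← neg_eq_iff_eq_neg.2 (hQB x), mul_neg, neg_neg]
  have hrB : ∀ x, B * r x = -(r x * B) := by
    intro x
    simp only [r]
    rw [mul_smul_comm, hqB, smul_mul_assoc, smul_neg]
  have hqb : ∀ x, ‖q x‖ ≤ ‖B‖ * c := fun x =>
    (norm_mul_le _ _).trans (mul_le_mul_of_nonneg_left (hc x) (norm_nonneg _))
  have hrb : ∀ x, ‖r x‖ ≤ ‖B‖ * c := fun x => by
    have := hqb x
    simp only [r, norm_smul]
    norm_num
    linarith [norm_nonneg (q x)]
  obtain ⟨k₁, k₂, hk⟩ := exists_goursatIntegral hq.continuous hr.continuous hqb hrb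
  have hK := hk.project B_mul_B hq.continuous hqB hrB
  set K₁ : ℝ × ℝ → M2 := fun z => commProj B (k₁ z) with hK₁
  set K₂ : ℝ × ℝ → M2 := fun z => anticommProj B (k₂ z) with hK₂
  obtain ⟨s1, s2⟩ := hK.contDiff (p + 1) (by exact_mod_cast hq) (by exact_mod_cast hr)
  have s1' : ContDiff ℝ ((p : WithTop ℕ∞) + 1) K₁ := by exact_mod_cast s1
  have s2' : ContDiff ℝ ((p : WithTop ℕ∞) + 1) K₂ := by exact_mod_cast s2
  have d1 : Differentiable ℝ K₁ := s1'.differentiable (by simp)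
  have d2 : Differentiable ℝ K₂ := s2'.differentiable (by simp)
  have p1 : ∀ z, commProj B (K₁ z) = K₁ z := fun z =>
    commProj_eq_self B_mul_B (mul_commProj B_mul_B _)
  have p2 : ∀ z, anticommProj B (K₂ z) = K₂ z := fun z =>
    anticommProj_eq_self B_mul_B (mul_anticommProj B_mul_B _)
  -- Derivatives inherit the commutation rules because the projections are continuous linear maps
  -- fixing `K₁` and `K₂`.
  have f1 : ∀ z v, B * fderiv ℝ K₁ z v = fderiv ℝ K₁ z v * B := by
    intro z v
    have h : fderiv ℝ K₁ z = (commProj B).comp (fderiv ℝ K₁ z) := by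
      have := ((commProj B).hasFDerivAt.comp z (d1 z).hasFDerivAt).fderiv
      rwa [show (commProj B : M2 → M2) ∘ K₁ = K₁ from funext p1] at this
    rw [h]
    exact mul_commProj B_mul_B _
  have f2 : ∀ z v, B * fderiv ℝ K₂ z v = -(fderiv ℝ K₂ z v * B) := by
    intro z v
    have h : fderiv ℝ K₂ z = (anticommProj B).comp (fderiv ℝ K₂ z) := by
      have := ((anticommProj B).hasFDerivAt.comp z (d2 z).hasFDerivAt).fderiv
      rwa [show (anticommProj B : M2 → M2) ∘ K₂ = K₂ from funext p2] at this
    rw [h]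
    exact mul_anticommProj B_mul_B _
  have g1 : ∀ z, fderiv ℝ K₁ z (1, 0) = q (z.1 + z.2) * K₂ z := fun z =>
    (hasDerivAt_fderiv_fst (d1 z)).unique (hK.hasDerivAt₁ hq.continuous z.1 z.2)
  have g2 : ∀ z, fderiv ℝ K₂ z (0, 1) = q (z.1 + z.2) * K₁ z := fun z =>
    (hasDerivAt_fderiv_snd (d2 z)).unique (hK.hasDerivAt₂ hq.continuous z.1 z.2)
  have hd : ∀ z v, fderiv ℝ (fun z => K₁ (charCoord z) + K₂ (charCoord z)) z v =
      fderiv ℝ K₁ (charCoord z) (charCoord v) + fderiv ℝ K₂ (charCoord z) (charCoord v) := by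
    intro z v
    have h := (((d1 (charCoord z)).hasFDerivAt.comp z charCoord.hasFDerivAt).add
      ((d2 (charCoord z)).hasFDerivAt.comp z charCoord.hasFDerivAt)).fderiv
    exact congrArg (fun L => L v) h
  refine ⟨fun z => K₁ (charCoord z) + K₂ (charCoord z), ?_, fun z => ?_, fun x => ?_, fun x => ?_⟩
  · exact (s1'.comp charCoord.contDiff).add (s2'.comp charCoord.contDiff)
  · obtain ⟨x, t⟩ := z
    have v1 : charCoord (1, 0) = (1 / 2 : ℝ) • ((1, 0) : ℝ × ℝ) + (1 / 2 : ℝ) • (0, 1) := by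
      rw [charCoord_apply]; norm_num
    have v2 : charCoord (0, 1) = (1 / 2 : ℝ) • ((1, 0) : ℝ × ℝ) - (1 / 2 : ℝ) • (0, 1) := by
      rw [charCoord_apply]; norm_num
    have hx : (charCoord (x, t)).1 + (charCoord (x, t)).2 = x := by
      rw [charCoord_apply]; ring
    rw [hd, hd, v1, v2]
    simp only [map_add, map_sub, map_smul, add_mul, sub_mul, smul_mul_assoc, mul_add, mul_smul_comm]
    rw [← f1, ← f1, ← neg_eq_iff_eq_neg.2 (f2 _ (1, 0)), ← neg_eq_iff_eq_neg.2 (f2 _ (0, 1)), g1, g2,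
      hx]
    have e : ∀ X : M2, B * (q x * X) = -(Q x * X) := by
      intro X
      simp only [q]
      rw [← mul_assoc, ← mul_assoc, B_mul_B]; noncomm_ring
    rw [e, e]
    module
  · have h0 : charCoord (x, x) = (x, 0) := by rw [charCoord_apply]; norm_num
    have h1 : K₂ (x, 0) = r x := by rw [hK.eq₂]; simp
    have h2 : B * K₁ (x, 0) = K₁ (x, 0) * B := mul_commProj B_mul_B _
    have h3 : B * q x = -Q x := by simp only [q]; rw [← mul_assoc, B_mul_B]; simp
    have h4 : r x * B = -(B * r x) := by rw [hrB, neg_neg]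
    simp only [h0, h1, mul_add, add_mul, h2, h4]
    simp only [r, mul_smul_comm, h3]
    module
  · have h0 : charCoord (x, -x) = (0, x) := by rw [charCoord_apply]; norm_num
    have h1 : K₁ (0, x) = 0 := by rw [hK.eq₁]; simp
    have h2 : B * K₂ (0, x) = -(K₂ (0, x) * B) := mul_anticommProj B_mul_B _
    simp only [h0, h1, zero_add, h2, neg_add_cancel]

end Kernel

end DiracNSBF

namespace DiracNSBF

/-! ### Geometry of the triangle -/

section Triangle

lemma isCompact_triangle (b : ℝ) : IsCompact (triangle b) := by
  refine (isCompact_Icc (a := ((0 : ℝ), -b)) (b := (b, b))).of_isClosed_subset ?_ ?_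
  · exact (isClosed_le continuous_const continuous_fst).inter
      ((isClosed_le continuous_fst continuous_const).inter
        (isClosed_le continuous_snd.abs continuous_fst))
  · rintro ⟨x, t⟩ ⟨h0, h1, h2⟩
    simp only at h0 h1 h2
    have := abs_le.1 h2
    exact ⟨⟨h0, by simp only; linarith⟩, ⟨h1, by simp only; linarith⟩⟩

lemma convex_triangle (b : ℝ) : Convex ℝ (triangle b) := by
  rintro ⟨x, t⟩ ⟨h0, h1, h2⟩ ⟨x', t'⟩ ⟨h0', h1', h2'⟩ a c ha hc hac
  simp only at h0 h1 h2 h0' h1' h2'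
  refine ⟨?_, ?_, ?_⟩
  · simp only [Prod.smul_mk, Prod.mk_add_mk, smul_eq_mul]; positivity
  · simp only [Prod.smul_mk, Prod.mk_add_mk, smul_eq_mul]
    calc a * x + c * x' ≤ a * b + c * b := by gcongr
      _ = b := by rw [← add_mul, hac, one_mul]
  · simp only [Prod.smul_mk, Prod.mk_add_mk, smul_eq_mul]
    calc |a * t + c * t'| ≤ |a * t| + |c * t'| := abs_add_le _ _
      _ = a * |t| + c * |t'| := by rw [abs_mul, abs_mul, abs_of_nonneg ha, abs_of_nonneg hc]
      _ ≤ _ := by gcongr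

lemma uniqueDiffOn_triangle {b : ℝ} (hb : 0 < b) : UniqueDiffOn ℝ (triangle b) := by
  refine uniqueDiffOn_convex (convex_triangle b) ⟨(b / 2, 0), ?_⟩
  refine interior_maximal (s := triangle b)
    (t := {z : ℝ × ℝ | 0 < z.1 ∧ z.1 < b ∧ |z.2| < z.1}) ?_ ?_ ?_
  · exact fun z hz => ⟨hz.1.le, hz.2.1.le, hz.2.2.le⟩
  · exact (isOpen_lt continuous_const continuous_fst).inter
      ((isOpen_lt continuous_fst continuous_const).inter
        (isOpen_lt continuous_snd.abs continuous_fst))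
  · exact ⟨by simp only; linarith, by simp only; linarith, by simp only [abs_zero]; linarith⟩

lemma mem_triangle_of_char {b x y : ℝ} (hx : 0 ≤ x) (hy : 0 ≤ y) (hxy : x + y ≤ b) :
    (x + y, x - y) ∈ triangle b :=
  ⟨by simp only; linarith, hxy, by simp only [abs_le]; constructor <;> linarith⟩

end Triangle

/-! ### Uniqueness of the transmutation kernel -/

section KernelUniqueness

lemma IsGlobalKernel.isTransmutationKernel {p : ℕ} {Q : ℝ → M2} {K : ℝ × ℝ → M2}
    (h : IsGlobalKernel ((p : WithTop ℕ∞) + 1) Q K) {b : ℝ} (hb : 0 < b) {Q₀ : ℝ → M2}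
    (hQ : Set.EqOn Q Q₀ (Set.Icc 0 b)) : IsTransmutationKernel b Q₀ K := by
  have hd : Differentiable ℝ K := h.contDiff.differentiable (by simp)
  refine ⟨(h.contDiff.of_le (by simp)).contDiffOn, fun z hz => ?_, fun x hx => ?_, fun x _ => ?_⟩
  · rw [(hd z).fderivWithin (uniqueDiffOn_triangle hb z hz), h.pde, hQ ⟨hz.1, hz.2.1⟩]
  · rw [h.goursat_diag, hQ hx]
  · exact h.goursat_antidiag x

/-- The difference of two kernels has zero Goursat data. Its two projections are differentiated
along the characteristic directions `(1,1)` and `(1,-1)`, within the triangle, and integrated to the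
system of `goursat_unique`. -/
theorem IsTransmutationKernel.eqOn {b : ℝ} {Q₀ Q : ℝ → M2} (hQc : Continuous Q)
    (hQB : ∀ x, B * Q x = -(Q x * B)) (hQ : Set.EqOn Q Q₀ (Set.Icc 0 b)) {K L : ℝ × ℝ → M2}
    (hK : IsTransmutationKernel b Q₀ K) (hL : IsTransmutationKernel b Q₀ L) :
    Set.EqOn K L (triangle b) := by
  set D : ℝ × ℝ → M2 := fun z => K z - L z with hD
  set D' : ℝ × ℝ → (ℝ × ℝ →L[ℝ] M2) := fun z =>
    fderivWithin ℝ K (triangle b) z - fderivWithin ℝ L (triangle b) z with hD'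
  have hd : ∀ z ∈ triangle b, HasFDerivWithinAt D (D' z) (triangle b) z := fun z hz =>
    ((hK.contDiffOn.differentiableOn one_ne_zero) z hz).hasFDerivWithinAt.sub
      ((hL.contDiffOn.differentiableOn one_ne_zero) z hz).hasFDerivWithinAt
  have hDc : ContinuousOn D (triangle b) := fun z hz => (hd z hz).continuousWithinAt
  have hpde : ∀ z ∈ triangle b, B * D' z (1, 0) + D' z (0, 1) * B = -(Q z.1 * D z) := by
    intro z hz
    rw [hQ ⟨hz.1, hz.2.1⟩]
    simp only [D, D', sub_apply, mul_sub, sub_mul]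
    have h1 := hK.pde z hz
    have h2 := hL.pde z hz
    calc _ = (B * fderivWithin ℝ K (triangle b) z (1, 0) +
          fderivWithin ℝ K (triangle b) z (0, 1) * B) -
          (B * fderivWithin ℝ L (triangle b) z (1, 0) +
          fderivWithin ℝ L (triangle b) z (0, 1) * B) := by abel
      _ = _ := by rw [h1, h2]; abel
  set k₁ : ℝ × ℝ → M2 := fun w => commProj B (D (w.1 + w.2, w.1 - w.2)) with hk₁
  set k₂ : ℝ × ℝ → M2 := fun w => anticommProj B (D (w.1 + w.2, w.1 - w.2)) with hk₂
  set S : Set (ℝ × ℝ) := {z | 0 ≤ z.1 ∧ 0 ≤ z.2 ∧ z.1 + z.2 ≤ b} with hS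
  have hDS : ContinuousOn (fun w : ℝ × ℝ => D (w.1 + w.2, w.1 - w.2)) S :=
    hDc.comp (by fun_prop) fun w hw => mem_triangle_of_char hw.1 hw.2.1 hw.2.2
  have c1 : ContinuousOn k₁ S := (commProj B).continuous.comp_continuousOn hDS
  have c2 : ContinuousOn k₂ S := (anticommProj B).continuous.comp_continuousOn hDS
  have e1 : ∀ x y, 0 ≤ x → 0 ≤ y → x + y ≤ b →
      k₁ (x, y) = ∫ s in (0 : ℝ)..x, (B * Q (s + y)) * k₂ (s, y) := by
    intro x y hx hy hxy
    have hmaps : ∀ s ∈ Set.Icc 0 x, (s, y) ∈ S := fun s hs =>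
      ⟨hs.1, hy, by simp only; linarith [hs.2]⟩
    have hmaps' : ∀ s ∈ Set.Icc 0 x, (s + y, s - y) ∈ triangle b := fun s hs =>
      mem_triangle_of_char hs.1 hy (by linarith [hs.2])
    have hder : ∀ s ∈ Set.Icc 0 x, HasDerivWithinAt (fun s => k₁ (s, y))
        ((B * Q (s + y)) * k₂ (s, y)) (Set.Icc 0 x) s := by
      intro s hs
      have hin : HasDerivWithinAt (fun s : ℝ => (s + y, s - y)) (1, 1) (Set.Icc 0 x) s :=
        ((hasDerivAt_id s).add_const y).hasDerivWithinAt.prodMk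
          ((hasDerivAt_id s).sub_const y).hasDerivWithinAt
      have h1 := (hd _ (hmaps' s hs)).comp_hasDerivWithinAt s hin hmaps'
      have h2 := (commProj B).hasFDerivAt.comp_hasDerivWithinAt s h1
      refine h2.congr_deriv ?_
      rw [show ((1, 1) : ℝ × ℝ) = (1, 0) + (0, 1) by simp, map_add]
      exact commProj_add_of_system B_mul_B (hQB _) (hpde _ (hmaps' s hs))
    have hcont : ContinuousOn (fun s => (B * Q (s + y)) * k₂ (s, y)) (Set.Icc 0 x) :=
      (by fun_prop : Continuous fun s => B * Q (s + y)).continuousOn.mul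
        (c2.comp (by fun_prop) hmaps)
    have hftc := intervalIntegral.integral_eq_sub_of_hasDerivAt_of_le hx
      (fun s hs => (hder s hs).continuousWithinAt)
      (fun s hs => (hder s (Set.Ioo_subset_Icc_self hs)).hasDerivAt (Icc_mem_nhds hs.1 hs.2))
      (hcont.intervalIntegrable_of_Icc hx)
    have h0 : k₁ (0, y) = 0 := by
      refine commProj_eq_zero B_mul_B ?_
      have hy' : y ∈ Set.Icc 0 b := ⟨hy, by linarith⟩
      have h1 := hK.goursat_antidiag y hy'
      have h2 := hL.goursat_antidiag y hy'
      simp only [D, zero_add, zero_sub, mul_sub, sub_mul]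
      rw [eq_neg_of_add_eq_zero_left h1, eq_neg_of_add_eq_zero_left h2]
      abel
    rw [hftc, h0, sub_zero]
  have e2 : ∀ x y, 0 ≤ x → 0 ≤ y → x + y ≤ b →
      k₂ (x, y) = ∫ s in (0 : ℝ)..y, (B * Q (x + s)) * k₁ (x, s) := by
    intro x y hx hy hxy
    have hmaps : ∀ s ∈ Set.Icc 0 y, (x, s) ∈ S := fun s hs =>
      ⟨hx, hs.1, by simp only; linarith [hs.2]⟩
    have hmaps' : ∀ s ∈ Set.Icc 0 y, (x + s, x - s) ∈ triangle b := fun s hs =>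
      mem_triangle_of_char hx hs.1 (by linarith [hs.2])
    have hder : ∀ s ∈ Set.Icc 0 y, HasDerivWithinAt (fun s => k₂ (x, s))
        ((B * Q (x + s)) * k₁ (x, s)) (Set.Icc 0 y) s := by
      intro s hs
      have hin : HasDerivWithinAt (fun s : ℝ => (x + s, x - s)) (1, -1) (Set.Icc 0 y) s :=
        ((hasDerivAt_id s).const_add x).hasDerivWithinAt.prodMk
          ((hasDerivAt_id s).const_sub x).hasDerivWithinAt
      have h1 := (hd _ (hmaps' s hs)).comp_hasDerivWithinAt s hin hmaps'
      have h2 := (anticommProj B).hasFDerivAt.comp_hasDerivWithinAt s h1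
      refine h2.congr_deriv ?_
      rw [show ((1, -1) : ℝ × ℝ) = (1, 0) - (0, 1) by simp, map_sub]
      exact anticommProj_sub_of_system B_mul_B (hQB _) (hpde _ (hmaps' s hs))
    have hcont : ContinuousOn (fun s => (B * Q (x + s)) * k₁ (x, s)) (Set.Icc 0 y) :=
      (by fun_prop : Continuous fun s => B * Q (x + s)).continuousOn.mul
        (c1.comp (by fun_prop) hmaps)
    have hftc := intervalIntegral.integral_eq_sub_of_hasDerivAt_of_le hy
      (fun s hs => (hder s hs).continuousWithinAt)
      (fun s hs => (hder s (Set.Ioo_subset_Icc_self hs)).hasDerivAt (Icc_mem_nhds hs.1 hs.2))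
      (hcont.intervalIntegrable_of_Icc hy)
    have h0 : k₂ (x, 0) = 0 := by
      refine anticommProj_eq_zero B_mul_B ?_
      have hx' : x ∈ Set.Icc 0 b := ⟨hx, by linarith⟩
      have h1 := hK.goursat_diag x hx'
      have h2 := hL.goursat_diag x hx'
      simp only [D, add_zero, sub_zero, mul_sub, sub_mul]
      rw [sub_eq_iff_eq_add.1 h1, sub_eq_iff_eq_add.1 h2]
      abel
    rw [hftc, h0, sub_zero]
  rintro ⟨x, t⟩ ⟨hx0, hxb, hxt⟩
  simp only at hx0 hxb hxt
  have ht := abs_le.1 hxt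
  obtain ⟨z1, z2⟩ := goursat_unique (by fun_prop : Continuous fun s => B * Q s) c1 c2 e1 e2
    (x := (x + t) / 2) (y := (x - t) / 2) (by linarith) (by linarith) (by linarith)
  have hz := commProj_add_anticommProj (J := B) (D (x, t))
  simp only [k₁, k₂, show (x + t) / 2 + (x - t) / 2 = x by ring,
    show (x + t) / 2 - (x - t) / 2 = t by ring] at z1 z2
  rw [z1, z2, add_zero] at hz
  exact (sub_eq_zero.1 hz.symm)

end KernelUniqueness

/-! ### The transmuted `U0` solves the Dirac system -/

section Transmutation

lemma hasDerivAt_U0 (l : ℂ) (x : ℝ) : HasDerivAt (U0 l) (-(l • (B * U0 l x))) x := by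
  have hl : HasDerivAt (fun x : ℝ => l * (x : ℂ)) l x := by
    simpa using (Complex.ofRealCLM.hasDerivAt (x := x)).const_mul l
  have hcos := (Complex.hasDerivAt_cos (l * x)).comp x hl
  have hsin := (Complex.hasDerivAt_sin (l * x)).comp x hl
  have h := (hcos.smul_const (1 : M2)).sub (hsin.smul_const B)
  rw [show U0 l = fun x : ℝ => Complex.cos (l * x) • (1 : M2) - Complex.sin (l * x) • B from
    funext (U0_eq l)]
  refine h.congr_deriv ?_
  simp only [mul_sub, mul_smul_comm, B_mul_B, mul_one]
  module

/-- The image of `U0` under the transmutation operator. -/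
noncomputable def transmute (K : ℝ × ℝ → M2) (l : ℂ) (x : ℝ) : M2 :=
  U0 l x + ∫ t in (-x)..x, K (x, t) * U0 l t

/-- Leibniz's rule with moving endpoints: the integral is a difference of a two-variable primitive
along the curves `(y,y)` and `(-y,y)`. -/
lemma hasDerivAt_transmute {p : ℕ} {Q : ℝ → M2} {K : ℝ × ℝ → M2}
    (h : IsGlobalKernel ((p : WithTop ℕ∞) + 1) Q K) (l : ℂ) (x : ℝ) :
    HasDerivAt (transmute K l) (-(l • (B * U0 l x)) + (K (x, x) * U0 l x + K (x, -x) * U0 l (-x) +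
      ∫ t in (-x)..x, fderiv ℝ K (x, t) (1, 0) * U0 l t)) x := by
  have hd : Differentiable ℝ K := h.contDiff.differentiable (by simp)
  have hKc : Continuous K := h.contDiff.continuous
  have hUc := continuous_U0 l
  have hK' : Continuous fun z : ℝ × ℝ => fderiv ℝ K z (1, 0) :=
    (h.contDiff.continuous_fderiv (by simp)).clm_apply continuous_const
  set f : ℝ × ℝ → M2 := fun z => K z.swap * U0 l z.1 with hf
  set g : ℝ × ℝ → M2 := fun z => fderiv ℝ K z.swap (1, 0) * U0 l z.1 with hg
  have hfc : Continuous f := by fun_prop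
  have hgc : Continuous g := by fun_prop
  have hfg : ∀ s y, HasDerivAt (fun y => f (s, y)) (g (s, y)) y := fun s y =>
    (hasDerivAt_fderiv_fst (hd (y, s))).mul_const (U0 l s)
  have hP := hasFDerivAt_primitive hfc hgc hfg
  have h1 := HasFDerivAt.comp_hasDerivAt (l := primitive f) (f := fun y => (y, y)) x (hP (x, x))
    ((hasDerivAt_id x).prodMk (hasDerivAt_id x))
  have h2 := HasFDerivAt.comp_hasDerivAt (l := primitive f) (f := fun y => (-y, y)) x (hP (-x, x))
    ((hasDerivAt_id x).neg.prodMk (hasDerivAt_id x))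
  have hi : ∀ (φ : ℝ × ℝ → M2), Continuous φ → ∀ y, ∫ t in (-y)..y, φ (t, y) =
      primitive φ (y, y) - primitive φ (-y, y) := by
    intro φ hφ y
    simp only [primitive]
    rw [intervalIntegral.integral_interval_sub_left] <;>
      exact Continuous.intervalIntegrable (by fun_prop) _ _
  have e : transmute K l = fun x => U0 l x + (primitive f (x, x) - primitive f (-x, x)) := by
    funext y
    rw [← hi f hfc]
    rfl
  rw [e]
  refine ((hasDerivAt_U0 l x).add (h1.sub h2)).congr_deriv ?_
  have := hi g hgc x
  simp only [g, Prod.swap_prod_mk] at this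
  rw [this]
  simp [f, g]
  abel

/-- The equation for `K` replaces `B K_x` by `K_t B`; integrating by parts moves the `t`-derivative
onto `U0`, which yields `λ`. The boundary terms cancel by the two Goursat conditions, the diagonal
one also absorbing `Q U0`. -/
lemma transmute_system {p : ℕ} {Q : ℝ → M2} {K : ℝ × ℝ → M2}
    (h : IsGlobalKernel ((p : WithTop ℕ∞) + 1) Q K) (l : ℂ) (x : ℝ) :
    B * (-(l • (B * U0 l x)) + (K (x, x) * U0 l x + K (x, -x) * U0 l (-x) +
      ∫ t in (-x)..x, fderiv ℝ K (x, t) (1, 0) * U0 l t)) + Q x * transmute K l x =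
      l • transmute K l x := by
  have hd : Differentiable ℝ K := h.contDiff.differentiable (by simp)
  have hKc : Continuous K := h.contDiff.continuous
  have hUc := continuous_U0 l
  have hK1 : Continuous fun z : ℝ × ℝ => fderiv ℝ K z (1, 0) :=
    (h.contDiff.continuous_fderiv (by simp)).clm_apply continuous_const
  have hK2 : Continuous fun z : ℝ × ℝ => fderiv ℝ K z (0, 1) :=
    (h.contDiff.continuous_fderiv (by simp)).clm_apply continuous_const
  have hint : ∀ φ : ℝ → M2, Continuous φ → IntervalIntegrable φ MeasureTheory.volume (-x) x :=
    fun φ hφ => hφ.intervalIntegrable _ _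
  have hcm : ∀ (C : M2) (φ : ℝ → M2), Continuous φ →
      C * ∫ t in (-x)..x, φ t = ∫ t in (-x)..x, C * φ t := fun C φ hφ =>
    ((ContinuousLinearMap.mul ℝ M2 C).intervalIntegral_comp_comm (hint φ hφ)).symm
  have hcs : ∀ (φ : ℝ → M2), l • ∫ t in (-x)..x, φ t = ∫ t in (-x)..x, l • φ t :=
    fun φ => (intervalIntegral.integral_smul l φ).symm
  have parts : ∫ t in (-x)..x, (fderiv ℝ K (x, t) (0, 1) * (B * U0 l t) + l • (K (x, t) * U0 l t)) =
      K (x, x) * (B * U0 l x) - K (x, -x) * (B * U0 l (-x)) := by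
    refine intervalIntegral.integral_eq_sub_of_hasDerivAt
      (f := fun t => K (x, t) * (B * U0 l t)) (fun t _ => ?_) (hint _ (by fun_prop))
    refine ((hasDerivAt_fderiv_snd (hd (x, t))).mul ((hasDerivAt_U0 l t).const_mul B)).congr_deriv ?_
    simp only [mul_neg, mul_smul_comm, ← mul_assoc B B, B_mul_B, neg_mul, one_mul, smul_neg, neg_neg]
  have hpde : ∀ t, B * (fderiv ℝ K (x, t) (1, 0) * U0 l t) + Q x * (K (x, t) * U0 l t) =
      -(fderiv ℝ K (x, t) (0, 1) * (B * U0 l t)) := by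
    intro t
    have := congrArg (· * U0 l t) (h.pde (x, t))
    simp only [add_mul, neg_mul, mul_assoc] at this
    rw [← sub_eq_zero] at this ⊢
    rw [← this]
    abel
  have g1 := congrArg (· * U0 l x) (h.goursat_diag x)
  have g2 := congrArg (· * U0 l (-x)) (h.goursat_antidiag x)
  simp only [add_mul, sub_mul, neg_mul, mul_assoc, zero_mul] at g1 g2
  have hI : B * (∫ t in (-x)..x, fderiv ℝ K (x, t) (1, 0) * U0 l t) +
      Q x * (∫ t in (-x)..x, K (x, t) * U0 l t) - l • (∫ t in (-x)..x, K (x, t) * U0 l t) =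
      -(K (x, x) * (B * U0 l x) - K (x, -x) * (B * U0 l (-x))) := by
    rw [hcm _ _ (by fun_prop), hcm _ _ (by fun_prop), hcs, ← intervalIntegral.integral_add
      (hint _ (by fun_prop)) (hint _ (by fun_prop)), ← intervalIntegral.integral_sub
      (hint _ (by fun_prop)) (hint _ (by fun_prop)), ← parts, ← intervalIntegral.integral_neg]
    refine intervalIntegral.integral_congr fun t _ => ?_
    simp only [hpde]
    abel
  simp only [transmute, mul_add, mul_neg, mul_smul_comm, ← mul_assoc B B, B_mul_B, neg_mul, one_mul,
    smul_neg, neg_neg, smul_add]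
  linear_combination (norm := module) hI + g1 + g2

lemma IsGlobalKernel.isMatrixSolution {p : ℕ} {Q : ℝ → M2} {K : ℝ × ℝ → M2}
    (h : IsGlobalKernel ((p : WithTop ℕ∞) + 1) Q K) {b : ℝ} {Q₀ : ℝ → M2}
    (hQ : Set.EqOn Q Q₀ (Set.Icc 0 b)) (l : ℂ) : IsMatrixSolution b Q₀ l (transmute K l) := by
  refine ⟨?_, fun x => (-(l • (B * U0 l x)) + (K (x, x) * U0 l x + K (x, -x) * U0 l (-x) +
      ∫ t in (-x)..x, fderiv ℝ K (x, t) (1, 0) * U0 l t)), fun x hx =>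
      ⟨(hasDerivAt_transmute h l x).hasDerivWithinAt, ?_⟩⟩
  · simp [transmute, U0_eq]
  · rw [← hQ hx]
    exact transmute_system h l x

/-- Multiplication by `-B` turns the system into the linear equation `U' = -B(λ - Q)U`, whose right
side is uniformly Lipschitz in `U`. -/
theorem IsMatrixSolution.eqOn {b : ℝ} {Q : ℝ → M2} (hQ : ContinuousOn Q (Set.Icc 0 b)) {l : ℂ}
    {U V : ℝ → M2} (hU : IsMatrixSolution b Q l U) (hV : IsMatrixSolution b Q l V) :
    Set.EqOn U V (Set.Icc 0 b) := by
  obtain ⟨c, hc⟩ := isCompact_Icc.exists_bound_of_continuousOn hQ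
  obtain ⟨hU0, U', hU'⟩ := hU
  obtain ⟨hV0, V', hV'⟩ := hV
  have key : ∀ {W W' : ℝ → M2}, (∀ x ∈ Set.Icc 0 b,
      HasDerivWithinAt W (W' x) (Set.Icc 0 b) x ∧ B * W' x + Q x * W x = l • W x) →
      ∀ x ∈ Set.Icc 0 b, W' x = (-(B * (l • 1 - Q x))) * W x := by
    intro W W' hW x hx
    have h := congrArg (fun X => -(B * X)) (hW x hx).2
    simp only [mul_add, ← mul_assoc B B, B_mul_B, neg_mul, one_mul, neg_add, neg_neg] at h
    rw [← sub_eq_iff_eq_add'.2 (h.symm.trans (add_comm _ _))]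
    simp only [neg_mul, mul_assoc, sub_mul, smul_mul_assoc, one_mul, mul_sub]
    abel
  have hlip : ∀ t ∈ Set.Ico 0 b, LipschitzOnWith (‖B‖₊ * (‖l • (1 : M2)‖₊ + c.toNNReal))
      (fun X => (-(B * (l • 1 - Q t))) * X) Set.univ := by
    intro t ht
    refine LipschitzOnWith.of_dist_le_mul fun X _ Y _ => ?_
    rw [dist_eq_norm, dist_eq_norm, ← mul_sub]
    refine (norm_mul_le _ _).trans ?_
    gcongr
    rw [norm_neg]
    refine (norm_mul_le _ _).trans ?_
    push_cast
    gcongr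
    refine (norm_sub_le _ _).trans ?_
    gcongr
    exact (hc t (Set.Ico_subset_Icc_self ht)).trans (Real.le_coe_toNNReal c)
  have side : ∀ {W W' : ℝ → M2}, (∀ x ∈ Set.Icc 0 b,
      HasDerivWithinAt W (W' x) (Set.Icc 0 b) x ∧ B * W' x + Q x * W x = l • W x) →
      ∀ x ∈ Set.Ico 0 b, HasDerivWithinAt W ((-(B * (l • 1 - Q x))) * W x) (Set.Ici x) x := by
    intro W W' hW x hx
    have hx' := Set.Ico_subset_Icc_self hx
    rw [← key hW x hx']
    exact (hW x hx').1.mono_of_mem_nhdsWithin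
      (Filter.mem_of_superset (Icc_mem_nhdsGE hx.2) (Set.Icc_subset_Icc_left hx.1))
  exact ODE_solution_unique_of_mem_Icc_right hlip
    (fun x hx => (hU' x hx).1.continuousWithinAt) (side hU') (fun _ _ => Set.mem_univ _)
    (fun x hx => (hV' x hx).1.continuousWithinAt) (side hV') (fun _ _ => Set.mem_univ _)
    (hU0.trans hV0.symm)

end Transmutation

end DiracNSBF

namespace DiracNSBF

/-! ### Operator norm of `U0` -/

section NormBounds

lemma star_B : star B = -B := by
  ext i j
  fin_cases i <;> fin_cases j <;> simp [B, Matrix.star_apply]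

lemma norm_le_one_of_star_mul_self {X : M2} (h : star X * X = 1) : ‖X‖ ≤ 1 := by
  have h1 := CStarRing.norm_star_mul_self (x := X)
  rw [h, CStarRing.norm_one] at h1
  nlinarith [norm_nonneg X]

lemma norm_B_le : ‖B‖ ≤ 1 :=
  norm_le_one_of_star_mul_self (by rw [star_B, neg_mul, B_mul_B, neg_neg])

lemma norm_rotation_le (a : ℝ) : ‖Complex.cos a • (1 : M2) - Complex.sin a • B‖ ≤ 1 := by
  refine norm_le_one_of_star_mul_self ?_
  rw [star_sub, star_smul, star_smul, star_one, star_B, ← Complex.ofReal_cos, ← Complex.ofReal_sin,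
    Complex.star_def, Complex.conj_ofReal, Complex.conj_ofReal]
  have h : ((Real.cos a : ℝ) : ℂ) ^ 2 + ((Real.sin a : ℝ) : ℂ) ^ 2 = 1 := by
    exact_mod_cast Real.cos_sq_add_sin_sq a
  simp only [smul_neg, sub_neg_eq_add, add_mul, mul_sub, smul_mul_assoc, mul_smul_comm, mul_one,
    one_mul, B_mul_B]
  calc _ = (((Real.cos a : ℝ) : ℂ) ^ 2 + ((Real.sin a : ℝ) : ℂ) ^ 2) • (1 : M2) := by module
    _ = 1 := by rw [h, one_smul]

/-- `U0` is a real rotation, which is unitary, times `cosh y - i sinh y · B`, whose norm is at most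
`cosh |y| + sinh |y|`. No constant is lost. -/
lemma norm_U0_le (l : ℂ) (t : ℝ) : ‖U0 l t‖ ≤ Real.exp (|l.im| * |t|) := by
  set y : ℝ := l.im * t with hy
  have hz : l * t = ((l.re * t : ℝ) : ℂ) + (y : ℂ) * Complex.I := by
    apply Complex.ext <;> simp [hy]
  have hfac : U0 l t = (Complex.cos ((l.re * t : ℝ) : ℂ) • (1 : M2) -
      Complex.sin ((l.re * t : ℝ) : ℂ) • B) *
      (Complex.cosh y • (1 : M2) - (Complex.sinh y * Complex.I) • B) := by
    rw [U0_eq, hz, Complex.cos_add, Complex.sin_add, Complex.cos_mul_I, Complex.sin_mul_I]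
    simp only [sub_mul, mul_sub, smul_mul_assoc, mul_smul_comm, mul_one, one_mul, B_mul_B]
    module
  have h2 : ‖Complex.cosh y • (1 : M2) - (Complex.sinh y * Complex.I) • B‖ ≤ Real.exp |y| := by
    refine (norm_sub_le _ _).trans ?_
    rw [norm_smul, norm_smul, norm_mul, Complex.norm_I, mul_one, CStarRing.norm_one, mul_one,
      ← Complex.ofReal_cosh, ← Complex.ofReal_sinh, Complex.norm_real, Complex.norm_real,
      Real.norm_eq_abs, Real.norm_eq_abs, Real.abs_sinh, abs_of_pos (Real.cosh_pos _),
      ← Real.cosh_abs]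
    calc Real.cosh |y| + Real.sinh |y| * ‖B‖ ≤ Real.cosh |y| + Real.sinh |y| * 1 := by
          have : 0 ≤ Real.sinh |y| := Real.sinh_nonneg_iff.2 (abs_nonneg _)
          gcongr
          exact norm_B_le
      _ = Real.exp |y| := by rw [mul_one, Real.cosh_add_sinh]
  rw [hfac, ← abs_mul]
  calc _ ≤ 1 * Real.exp |y| := (norm_mul_le _ _).trans
        (mul_le_mul (norm_rotation_le _) h2 (norm_nonneg _) zero_le_one)
    _ = _ := one_mul _

lemma norm_integral_mul_U0_le {x ε : ℝ} (hx : 0 ≤ x) {R : ℝ → M2}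
    (hR : ∀ t ∈ Set.Icc (-x) x, ‖R t‖ ≤ ε) (l : ℂ) :
    ‖∫ t in (-x)..x, R t * U0 l t‖ ≤ ε * ∫ t in (-x)..x, Real.exp (|l.im| * |t|) := by
  have hε : 0 ≤ ε := (norm_nonneg _).trans (hR x ⟨by linarith, le_rfl⟩)
  rw [← intervalIntegral.integral_const_mul]
  refine intervalIntegral.norm_integral_le_of_norm_le (by linarith)
    (Filter.Eventually.of_forall fun t ht => ?_)
    (Continuous.intervalIntegrable (by fun_prop) _ _)
  exact (norm_mul_le _ _).trans (mul_le_mul (hR t (Set.Ioc_subset_Icc_self ht)) (norm_U0_le l t)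
    (norm_nonneg _) hε)

lemma integral_exp_abs_symm {γ : ℝ} (hγ : γ ≠ 0) {x : ℝ} (hx : 0 ≤ x) :
    ∫ t in (-x)..x, Real.exp (γ * |t|) = 2 * ((Real.exp (γ * x) - 1) / γ) := by
  rw [← intervalIntegral.integral_add_adjacent_intervals (b := 0)
    (Continuous.intervalIntegrable (by fun_prop) _ _)
    (Continuous.intervalIntegrable (by fun_prop) _ _), integral_neg_exp_mul_abs hγ hx,
    integral_exp_mul_abs hγ hx]
  ring

end NormBounds

/-! ### Truncation of the kernel and of the Bessel series -/

section KernelApproximation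

/-- Chain rule; the power of `x` is the `x^(p+1)` of `epsilon`. -/
lemma iteratedDeriv_vertical {E : Type*} [NormedAddCommGroup E] [NormedSpace ℝ E]
    {G : ℝ × ℝ → E} {n : ℕ} (hG : ContDiff ℝ n G) (x : ℝ) : ∀ k ≤ n, ∀ s,
    iteratedDeriv k (fun s => G (x, x * s)) s =
      x ^ k • iteratedFDeriv ℝ k G (x, x * s) (fun _ => (0, 1)) := by
  intro k
  induction k with
  | zero => intro _ s; simp
  | succ k ih =>
    intro hk s
    have ih' := ih (by omega)
    rw [iteratedDeriv_succ, show iteratedDeriv k (fun s => G (x, x * s)) = _ from funext ih']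
    have hd : HasFDerivAt (iteratedFDeriv ℝ k G) (fderiv ℝ (iteratedFDeriv ℝ k G) (x, x * s))
        (x, x * s) :=
      ((hG.differentiable_iteratedFDeriv (by exact_mod_cast hk)) _).hasFDerivAt
    have hin : HasDerivAt (fun s : ℝ => (x, x * s)) (0, x) s :=
      (hasDerivAt_const s x).prodMk (by simpa using (hasDerivAt_id s).const_mul x)
    have h1 := HasFDerivAt.comp_hasDerivAt (l := iteratedFDeriv ℝ k G)
      (f := fun s => (x, x * s)) s hd hin
    have h2 := ((ContinuousMultilinearMap.apply ℝ (fun _ : Fin k => ℝ × ℝ) E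
      (fun _ => (0, 1))).hasFDerivAt.comp_hasDerivAt s h1).const_smul (x ^ k)
    refine h2.deriv.trans ?_
    rw [iteratedFDeriv_succ_apply_left, show ((0, x) : ℝ × ℝ) = x • (0, 1) by simp, map_smul,
      pow_succ, mul_smul]
    rfl

/-- The given kernel matters only on the triangle; its derivatives there are those of the globally
smooth kernel. -/
lemma partialT_eq {b : ℝ} (hb : 0 < b) {m : ℕ} {K L : ℝ × ℝ → M2} (hL : ContDiff ℝ m L)
    (h : Set.EqOn K L (triangle b)) {z : ℝ × ℝ} (hz : z ∈ triangle b) :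
    partialT b m K z = iteratedFDeriv ℝ m L z (fun _ => (0, 1)) := by
  rw [partialT, iteratedFDerivWithin_congr h hz,
    iteratedFDerivWithin_eq_iteratedFDeriv (uniqueDiffOn_triangle hb) hL.contDiffAt hz]

/-- The truncated Fourier–Legendre series of the kernel. -/
noncomputable def truncKernel (K : ℝ × ℝ → M2) (N : ℕ) (x t : ℝ) : M2 :=
  ∑ n ∈ Finset.range (N + 1), (legendre n).eval (t / x) • ((1 / x) • coeff K n x)

lemma coeff_congr {b x : ℝ} {K L : ℝ × ℝ → M2} (h : Set.EqOn K L (triangle b))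
    (hx : x ∈ Set.Icc 0 b) (n : ℕ) : coeff K n x = coeff L n x := by
  rw [coeff, coeff]
  congr 1
  refine intervalIntegral.integral_congr fun t ht => ?_
  rw [Set.uIcc_of_le (by linarith [hx.1])] at ht
  have hz : (x, t) ∈ triangle b := ⟨hx.1, hx.2, abs_le.2 ht⟩
  simp only [h hz]

lemma lsum_eq_truncKernel {L : ℝ × ℝ → M2} (hL : Continuous L) (φ : M2 →L[ℝ] ℝ) (N : ℕ) {x : ℝ}
    (hx : 0 < x) (s : ℝ) :
    lsum (fun s => φ (L (x, x * s))) N s = φ (truncKernel L N x (x * s)) := by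
  rw [lsum, truncKernel, map_sum]
  refine Finset.sum_congr rfl fun n _ => ?_
  have h := intervalIntegral.integral_comp_mul_left (a := -1) (b := 1)
    (fun t : ℝ => (legendre n).eval (t / x) • L (x, t)) hx.ne'
  simp only [mul_neg, mul_one, mul_div_cancel_left₀ _ hx.ne'] at h
  have hc := continuous_eval_real (legendre n)
  have hφ : lcoeff (fun s => φ (L (x, x * s))) n =
      φ (∫ s in (-1 : ℝ)..1, (legendre n).eval s • L (x, x * s)) := by
    rw [← φ.intervalIntegral_comp_comm (Continuous.intervalIntegrable (by fun_prop) _ _), lcoeff]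
    refine intervalIntegral.integral_congr fun s _ => ?_
    simp [mul_comm]
  rw [hφ, h, coeff, mul_div_cancel_left₀ _ hx.ne', one_div]
  simp only [map_smul, smul_eq_mul]
  ring

/-- By duality it suffices to test with real functionals `φ`. The scalar estimate is linear in `A =
x^(p+1) ‖φ‖ M`, so its constant passes to the operator norm unchanged. -/
theorem norm_kernel_sub_truncKernel_le (p : ℕ) {L : ℝ × ℝ → M2}
    (hL : ContDiff ℝ ((p : WithTop ℕ∞) + 1) L) {x M : ℝ} (hx : 0 < x)
    (hM : ∀ t ∈ Set.Icc (-x) x, ‖iteratedFDeriv ℝ (p + 1) L (x, t) (fun _ => (0, 1))‖ ≤ M)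
    {N : ℕ} (hN : p + 1 < N) {t : ℝ} (ht : t ∈ Set.Icc (-x) x) :
    ‖L (x, t) - truncKernel L N x t‖ ≤ epsilon (4 * 2 ^ (p + 1) * (p + 1) ^ p) M p N x := by
  have hM0 : 0 ≤ M := (norm_nonneg _).trans (hM t ht)
  have hL' : ContDiff ℝ ((p + 1 : ℕ) : WithTop ℕ∞) L := by exact_mod_cast hL
  refine NormedSpace.norm_le_dual_bound ℝ _ (by unfold epsilon; positivity) fun φ => ?_
  have hs : t / x ∈ Set.Icc (-1 : ℝ) 1 := by
    rw [Set.mem_Icc, le_div_iff₀ hx, div_le_iff₀ hx]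
    exact ⟨by linarith [ht.1], by linarith [ht.2]⟩
  have hφL : ContDiff ℝ ((p + 1 : ℕ) : WithTop ℕ∞) (φ ∘ L) := φ.contDiff.comp hL'
  have hf : ContDiff ℝ ((p : WithTop ℕ∞) + 1) fun s => φ (L (x, x * s)) :=
    (φ.contDiff.comp hL).comp (contDiff_const.prodMk (contDiff_const.mul contDiff_id))
  have hA : ∀ s ∈ Set.Icc (-1 : ℝ) 1, |iteratedDeriv (p + 1) (fun s => φ (L (x, x * s))) s| ≤
      x ^ (p + 1) * (‖φ‖ * M) := by
    intro s hs
    have h := iteratedDeriv_vertical hφL x (p + 1) le_rfl s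
    simp only [Function.comp] at h
    rw [h,
      φ.iteratedFDeriv_comp_left hL'.contDiffAt le_rfl, smul_eq_mul, abs_mul, abs_of_pos (by positivity)]
    gcongr
    refine (φ.le_opNorm _).trans ?_
    gcongr
    exact hM _ ⟨by nlinarith [hs.1], by nlinarith [hs.2]⟩
  have h := abs_sub_lsum_le_of_contDiff p hf hA hN hs
  rw [lsum_eq_truncKernel hL.continuous φ N hx, mul_div_cancel₀ _ hx.ne', ← map_sub] at h
  rw [Real.norm_eq_abs]
  refine h.trans (le_of_eq ?_)
  rw [epsilon]
  ring

/-- Termwise integration; the factor `x` from rescaling to `[-1,1]` cancels the `1/x` of the kernel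
series. -/
lemma partialSum_eq (K : ℝ × ℝ → M2) (N : ℕ) (l : ℂ) {x : ℝ} (hx : 0 < x) :
    partialSum K N l x = U0 l x + ∫ t in (-x)..x, truncKernel K N x t * U0 l t := by
  have hU := continuous_U0 l
  have hc : ∀ n, Continuous fun t => (legendre n).eval (t / x) := fun n =>
    (continuous_eval_real (legendre n)).comp (by fun_prop)
  simp only [partialSum, truncKernel, Finset.sum_mul, smul_mul_assoc]
  have hi : ∀ n, Continuous fun t =>
      (legendre n).eval (t / x) • (1 / x : ℝ) • (coeff K n x * U0 l t) :=
    fun n => (hc n).smul (by fun_prop)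
  rw [intervalIntegral.integral_finsetSum fun n _ => (hi n).intervalIntegrable _ _]
  congr 1
  refine Finset.sum_congr rfl fun n _ => ?_
  have h := integral_legendre_smul_U0 n (coeff K n x) l hx
  simp only [smul_comm _ (1 / x : ℝ)]
  rw [intervalIntegral.integral_smul, h, smul_smul, one_div_mul_cancel hx.ne', one_smul]
  rfl

lemma coeff_zero (K : ℝ × ℝ → M2) (n : ℕ) : coeff K n 0 = 0 := by
  simp [coeff]

lemma partialSum_zero (K : ℝ × ℝ → M2) (N : ℕ) (l : ℂ) : partialSum K N l 0 = 1 := by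
  simp [partialSum, coeffTilde, coeff_zero, U0_eq]

end KernelApproximation

/-! ### Extension of the potential -/

section Potential

lemma B_mul_potential (u v : ℝ → ℂ) (x : ℝ) : B * potential u v x = -(potential u v x * B) := by
  ext i j
  fin_cases i <;> fin_cases j <;> simp [B, potential, Matrix.mul_apply]

/-- An arbitrary extension is projected onto the matrices anticommuting with `B`; on `[0,b]` the
projection changes nothing. -/
lemma exists_potential_extension (p : ℕ) {b : ℝ} (hb : 0 < b) {u v : ℝ → ℂ}
    (h : ContDiffOn ℝ ((p : WithTop ℕ∞) + 1) (potential u v) (Set.Icc 0 b)) :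
    ∃ Q : ℝ → M2, ContDiff ℝ ((p : WithTop ℕ∞) + 1) Q ∧ (∀ x, B * Q x = -(Q x * B)) ∧
      Set.EqOn Q (potential u v) (Set.Icc 0 b) ∧ ∃ c, ∀ x, ‖Q x‖ ≤ c := by
  have h' : ContDiffOn ℝ ((p + 1 : ℕ) : WithTop ℕ∞) (potential u v) (Set.Icc 0 b) := by
    exact_mod_cast h
  obtain ⟨F, hF, hFe, c, hc⟩ := exists_bounded_contDiff_extension hb (p + 1) h'
  have hF' : ContDiff ℝ ((p : WithTop ℕ∞) + 1) F := by exact_mod_cast hF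
  refine ⟨fun x => anticommProj B (F x), (anticommProj B).contDiff.comp hF',
    fun x => mul_anticommProj B_mul_B _, fun x hx => ?_, ‖anticommProj B‖ * c, fun x => ?_⟩
  · simp only [hFe hx]
    exact anticommProj_eq_self B_mul_B (B_mul_potential u v x)
  · exact ((anticommProj B).le_opNorm _).trans (mul_le_mul_of_nonneg_left (hc x) (norm_nonneg _))

end Potential

end DiracNSBF

/-! ### The main theorem -/

open DiracNSBF

theorem mainTheorem2 (p : ℕ) :
    ∃ C : ℝ, 0 < C ∧
      ∀ (b : ℝ) (_ : 0 < b) (u v : ℝ → ℂ)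
        (_ : ContDiffOn ℝ (p + 1) (DiracNSBF.potential u v) (Set.Icc 0 b)),
        (∀ l : ℂ, ∃ U : ℝ → DiracNSBF.M2,
          DiracNSBF.IsMatrixSolution b (DiracNSBF.potential u v) l U) ∧
        (∃ K : ℝ × ℝ → DiracNSBF.M2,
          DiracNSBF.IsTransmutationKernel b (DiracNSBF.potential u v) K) ∧
        ∀ K : ℝ × ℝ → DiracNSBF.M2,
          DiracNSBF.IsTransmutationKernel b (DiracNSBF.potential u v) K →
          ContDiffOn ℝ (p + 1) K (DiracNSBF.triangle b) ∧
          ∃ M : ℝ,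
            IsGreatest ((fun z => ‖DiracNSBF.partialT b (p + 1) K z‖) ''
              DiracNSBF.triangle b) M ∧
            ∀ U : ℂ → ℝ → DiracNSBF.M2,
              (∀ l : ℂ, DiracNSBF.IsMatrixSolution b (DiracNSBF.potential u v) l (U l)) →
              ∀ N : ℕ, p + 1 < N → ∀ x ∈ Set.Icc 0 b,
                (∀ l : ℝ,
                  ‖U (l : ℂ) x - DiracNSBF.partialSum K N (l : ℂ) x‖
                    ≤ 2 * x * DiracNSBF.epsilon C M p N x) ∧
                (∀ l : ℂ, l.im ≠ 0 →
                  ‖U l x - DiracNSBF.partialSum K N l x‖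
                    ≤ 2 * DiracNSBF.epsilon C M p N x *
                      ((Real.exp (|l.im| * x) - 1) / |l.im|)) := by
  refine ⟨4 * 2 ^ (p + 1) * (p + 1) ^ p, by positivity, fun b hb u v hQ => ?_⟩
  obtain ⟨Q, hQs, hQB, hQe, c, hQc⟩ := exists_potential_extension p hb hQ
  obtain ⟨L, hL⟩ := exists_globalKernel p hQs hQB hQc
  have hLK := hL.isTransmutationKernel hb hQe
  refine ⟨fun l => ⟨transmute L l, hL.isMatrixSolution hQe l⟩, ⟨L, hLK⟩, fun K hK => ?_⟩
  have hKL : Set.EqOn K L (triangle b) := hK.eqOn hQs.continuous hQB hQe hLK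
  have hKs : ContDiffOn ℝ (p + 1) K (triangle b) := hL.contDiff.contDiffOn.congr hKL
  have hLs : ContDiff ℝ ((p + 1 : ℕ) : WithTop ℕ∞) L := by exact_mod_cast hL.contDiff
  have hpT : ∀ z ∈ triangle b, partialT b (p + 1) K z =
      iteratedFDeriv ℝ (p + 1) L z (fun _ => (0, 1)) := fun z hz => partialT_eq hb hLs hKL hz
  obtain ⟨M, hM⟩ : ∃ M, IsGreatest ((fun z => ‖partialT b (p + 1) K z‖) '' triangle b) M := by
    refine IsCompact.exists_isGreatest ((isCompact_triangle b).image_of_continuousOn ?_)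
      ⟨_, (0, 0), ⟨le_rfl, hb.le, by simp⟩, rfl⟩
    have hcont : Continuous fun z => iteratedFDeriv ℝ (p + 1) L z (fun _ => ((0 : ℝ), (1 : ℝ))) :=
      (ContinuousMultilinearMap.apply ℝ (fun _ : Fin (p + 1) => ℝ × ℝ) M2
        (fun _ => (0, 1))).continuous.comp (hLs.continuous_iteratedFDeriv le_rfl)
    exact (hcont.continuousOn.congr hpT).norm
  refine ⟨hKs, M, hM, fun U hU N hN x hx => ?_⟩
  set ε := epsilon (4 * 2 ^ (p + 1) * (p + 1) ^ p) M p N x with hε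
  -- A single bound serves real and nonreal `λ`; the two claims differ only in the value of the
  -- integral, which is `2x` when `Im λ = 0`.
  have main : ∀ l : ℂ, ‖U l x - partialSum K N l x‖ ≤
      ε * ∫ t in (-x)..x, Real.exp (|l.im| * |t|) := by
    intro l
    have hUx : U l x = transmute L l x :=
      (hU l).eqOn hQ.continuousOn (hL.isMatrixSolution hQe l) hx
    -- At `x = 0` the scaled variable `t/x` is meaningless, but both functions equal the identity
    -- there.
    rcases hx.1.eq_or_lt with rfl | hx0
    · rw [(hU l).1, partialSum_zero]
      simp
    have hP : partialSum K N l x = partialSum L N l x := by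
      simp only [partialSum, coeffTilde, coeff_congr hKL hx]
    have hbound : ∀ t ∈ Set.Icc (-x) x, ‖L (x, t) - truncKernel L N x t‖ ≤ ε := fun t ht => by
      refine norm_kernel_sub_truncKernel_le p hL.contDiff hx0 (fun s hs => ?_) hN ht
      have hz : (x, s) ∈ triangle b := ⟨hx.1, hx.2, abs_le.2 hs⟩
      rw [← hpT _ hz]
      exact hM.2 ⟨_, hz, rfl⟩
    refine le_trans (le_of_eq ?_) (norm_integral_mul_U0_le hx.1 hbound l)
    have hLc := hL.contDiff.continuous
    have hUc := continuous_U0 l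
    have hTc : Continuous (truncKernel L N x) := continuous_finsetSum _ fun n _ =>
      ((continuous_eval_real (legendre n)).comp (by fun_prop : Continuous fun t : ℝ => t / x)).smul
        continuous_const
    rw [hUx, hP, partialSum_eq L N l hx0, transmute, add_sub_add_left_eq_sub,
      ← intervalIntegral.integral_sub (Continuous.intervalIntegrable (by fun_prop) _ _)
        (Continuous.intervalIntegrable (by fun_prop) _ _)]
    simp only [sub_mul]
  refine ⟨fun l => (main l).trans (le_of_eq ?_), fun l hl => (main l).trans (le_of_eq ?_)⟩
  · simp
    ring
  · rw [integral_exp_abs_symm (abs_ne_zero.2 hl) hx.1]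
    ring
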